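/- Let $d\ge 0$ be an integer. For $f\in\mathcal S'(\mathbb R^n)$ and a window $g\in\mathcal S(\mathbb R^n)\setminus\{0\}$, let $V_gf(x,\omega)=\langle f, e^{2\pi i\omega\cdot(\,\cdot\,)}g(\cdot-x)\rangle$ (bracket conjugate-linear in the second entry) be the short-time Fourier transform. For $1\le p,q\le\infty$ the modulation space $M^{p,q}(\mathbb R^n)$ consists of all $f\in\mathcal S'(\mathbb R^n)$ with $$\bigl\|\,\omega\mapsto\|V_gf(\cdot,\omega)\|_{L^p(dx)}\bigr\|_{L^q(d\omega)}<\infty,$$ and the Wiener amalgam space $W(\mathcal FL^p,L^q)(\mathbb R^n)$ of all $f\in\mathcal S'(\mathbb R^n)$ with $$\bigl\|\,x\mapsto\|V_gf(x,\cdot)\|_{L^p(d\omega)}\bigr\|_{L^q(dx)}<\infty.$$ For an invertible real $2d\times 2d$ matrix $A$ and $f\in\mathcal S'(\mathbb R^d)$ put $\mathcal B_Af=\mathcal F_2\mathfrak T_A(f\otimes\overline f)\in\mathcal S'(\mathbb R^{2d})$, where $\mathfrak T_AF(x,y)=F(A(x,y))$ and $\mathcal F_2F(x,\omega)=\int_{\mathbb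 R^d}e^{-2\pi i\omega\cdot y}F(x,y)\,dy$ are extended to $\mathcal S'(\mathbb R^{2d})$ by duality; formally, with $d\times d$ blocks $A_{ij}$, $$\mathcal B_Af(x,\omega)=\int_{\mathbb R^d}e^{-2\pi i\omega\cdot y}f(A_{11}x+A_{12}y)\,\overline{f(A_{21}x+A_{22}y)}\,dy .$$ Let $Wf=\mathcal B_{A}f$ for $A=\begin{pmatrix}I&\frac12I\\ I&-\frac12I\end{pmatrix}$ be the Wigner distribution. For $M\in\mathbb R^{d\times d}$ let $$A_M=\begin{pmatrix}I&M+\frac12I\\ I&M-\frac12I\end{pmatrix},\qquad \chi_M(\xi,\eta)=e^{2\pi i\,\eta\cdot M\xi},\qquad \theta_M=\mathcal F_\sigma\chi_M\in\mathcal S'(\mathbb R^{2d}),$$ where $\mathcal F_\sigma F(x,\omega)=\mathcal FF(\omega,-x)$ is the symplectic Fourier transform, with $\mathcal FF(\zeta)=\int_{\mathbb R^{2d}} e^{-2\pi i z\cdot\zeta}F(z)\,dz$, extended to tempered distributions. Theorem. Let $M\in\mathbb R^{d\times d}$ be invertible, and let the spaces below be described with an arbitrary fixed window $g\in\mathcal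 S(\mathbb R^{2d})\setminus\{0\}$. Then $$\theta_M\in M^{1,\infty}(\mathbb R^{2d})\cap W(\mathcal FL^1,L^\infty)(\mathbb R^{2d}).$$ Moreover, for every $f\in\mathcal S'(\mathbb R^d)$ and all $1\le p,q\le\infty$, $$Wf\in M^{p,q}(\mathbb R^{2d})\iff \mathcal B_{A_M}f\in M^{p,q}(\mathbb R^{2d}).$$ -/

import Mathlib

noncomputable section

open SchwartzMap MeasureTheory
open scoped ContDiff FourierTransform LineDeriv ENNReal

namespace CohenClass

section Aux

variable {V W : Type} [NormedAddCommGroup V] [NormedSpace ℝ V]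

theorem exists_sup_seminorm_comp_le (P : 𝓢(V, ℂ) →L[ℂ] 𝓢(V, ℂ)) (s : Finset (ℕ × ℕ)) :
    ∃ (s' : Finset (ℕ × ℕ)) (C : ℝ), 0 ≤ C ∧ ∀ Φ : 𝓢(V, ℂ),
      s.sup (schwartzSeminormFamily ℂ V ℂ) (P Φ) ≤
        C * s'.sup (schwartzSeminormFamily ℂ V ℂ) Φ := by
  have hw := schwartz_withSeminorms ℂ V ℂ
  have hs : Continuous fun Φ => s.sup (schwartzSeminormFamily ℂ V ℂ) Φ := by
    classical
    induction s using Finset.induction_on with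
    | empty => simpa using continuous_const
    | insert a t _ ih =>
      simp only [Finset.sup_insert, Seminorm.sup_apply]
      exact (hw.continuous_seminorm a).sup ih
  obtain ⟨s', C, -, h⟩ := Seminorm.bound_of_continuous hw
    ((s.sup (schwartzSeminormFamily ℂ V ℂ)).comp (P : 𝓢(V, ℂ) →ₗ[ℂ] 𝓢(V, ℂ)))
    (hs.comp P.continuous)
  exact ⟨s', C, C.2, fun Φ => h Φ⟩

theorem exists_norm_le_sup_seminorm (G : 𝓢(V, ℂ) →L[ℂ] ℂ) :
    ∃ (s : Finset (ℕ × ℕ)) (C : ℝ), 0 ≤ C ∧ ∀ Φ : 𝓢(V, ℂ),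
      ‖G Φ‖ ≤ C * s.sup (schwartzSeminormFamily ℂ V ℂ) Φ := by
  have hw := schwartz_withSeminorms ℂ V ℂ
  obtain ⟨s', C, -, h⟩ := Seminorm.bound_of_continuous hw
    ((normSeminorm ℂ ℂ).comp (G : 𝓢(V, ℂ) →ₗ[ℂ] ℂ))
    (continuous_norm.comp G.continuous)
  exact ⟨s', C, C.2, fun Φ => h Φ⟩

variable [NormedAddCommGroup W] [InnerProductSpace ℝ W] [FiniteDimensional ℝ W]

theorem contDiff_of_intertwining (T : 𝓢(V, ℂ) → W → ℂ) (D : W → 𝓢(V, ℂ) →L[ℂ] 𝓢(V, ℂ))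
    (hD : ∀ Φ z, ∃ L : W →L[ℝ] ℂ, HasFDerivAt (T Φ) L z ∧ ∀ m, L m = T (D m Φ) z)
    (Φ : 𝓢(V, ℂ)) : ContDiff ℝ ∞ (T Φ) := by
  rw [contDiff_infty]
  intro n
  induction n generalizing Φ with
  | zero =>
    rw [Nat.cast_zero, contDiff_zero, continuous_iff_continuousAt]
    intro z
    obtain ⟨L, hL, -⟩ := hD Φ z
    exact hL.continuousAt
  | succ n ih =>
    rw [Nat.cast_succ, contDiff_succ_iff_fderiv_apply]
    refine ⟨fun z => ?_, by simp, fun m => ?_⟩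
    · obtain ⟨L, hL, -⟩ := hD Φ z
      exact hL.differentiableAt
    · convert ih (D m Φ) using 1
      ext z
      obtain ⟨L, hL, h⟩ := hD Φ z
      rw [hL.fderiv, h]

/-- A family of functions `T Φ` that is bounded by Schwartz seminorms of `Φ` and for which
differentiation and multiplication by coordinates can be moved onto `Φ` has Schwartz decay. -/
theorem decay_of_intertwining (T : 𝓢(V, ℂ) → W → ℂ)
    (hb : ∃ (s : Finset (ℕ × ℕ)) (C : ℝ), 0 ≤ C ∧ ∀ (Φ : 𝓢(V, ℂ)) (z : W),
      ‖T Φ z‖ ≤ C * s.sup (schwartzSeminormFamily ℂ V ℂ) Φ)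
    (hadd : ∀ (Φ Ψ : 𝓢(V, ℂ)) z, T (Φ + Ψ) z = T Φ z + T Ψ z)
    (D : W → 𝓢(V, ℂ) →L[ℂ] 𝓢(V, ℂ))
    (hD : ∀ Φ z, ∃ L : W →L[ℝ] ℂ, HasFDerivAt (T Φ) L z ∧ ∀ m, L m = T (D m Φ) z)
    (X : W → 𝓢(V, ℂ) →L[ℂ] 𝓢(V, ℂ))
    (hX : ∀ m Φ z, T (X m Φ) z = (inner ℝ m z : ℝ) * T Φ z) (n : ℕ × ℕ) :
    ∃ (s : Finset (ℕ × ℕ)) (C : ℝ), 0 ≤ C ∧ ∀ (Φ : 𝓢(V, ℂ)) (z : W),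
      ‖z‖ ^ n.1 * ‖iteratedFDeriv ℝ n.2 (T Φ) z‖ ≤
        C * s.sup (schwartzSeminormFamily ℂ V ℂ) Φ := by
  obtain ⟨k, n⟩ := n
  dsimp only
  have hsm := contDiff_of_intertwining T D hD
  let b := stdOrthonormalBasis ℝ W
  have hsum : ∀ {ι : Type} (t : Finset ι) (Φ : ι → 𝓢(V, ℂ)) z,
      T (∑ i ∈ t, Φ i) z = ∑ i ∈ t, T (Φ i) z := by
    intro ι t Φ z
    have h0 : T 0 z = 0 := by simpa using hadd 0 0 z
    classical
    induction t using Finset.induction_on with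
    | empty => simpa using h0
    | insert a t ha ih => rw [Finset.sum_insert ha, Finset.sum_insert ha, hadd, ih]
  induction n with
  | zero =>
    let Y : 𝓢(V, ℂ) →L[ℂ] 𝓢(V, ℂ) := ∑ i, (X (b i)).comp (X (b i))
    have hY : ∀ Φ z, T (Y Φ) z = (‖z‖ : ℂ) ^ 2 * T Φ z := by
      intro Φ z
      have h1 : Y Φ = ∑ i, X (b i) (X (b i) Φ) := by
        simp [Y]
      rw [h1, hsum]
      simp only [hX, ← mul_assoc]
      rw [← Finset.sum_mul]
      congr 1
      have h2 := b.sum_sq_norm_inner_right z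
      have h3 : ((∑ i, ‖(inner ℝ (b i) z : ℝ)‖ ^ 2 : ℝ) : ℂ) = ((‖z‖ ^ 2 : ℝ) : ℂ) := by rw [h2]
      push_cast at h3
      rw [← h3]
      refine Finset.sum_congr rfl fun i _ => ?_
      rw [← sq, ← Complex.ofReal_pow, ← Complex.ofReal_pow, Real.norm_eq_abs, sq_abs]
    have hYk : ∀ (j : ℕ) Φ z, T ((Y ^ j) Φ) z = (‖z‖ : ℂ) ^ (2 * j) * T Φ z := by
      intro j
      induction j with
      | zero => intro Φ z; simp
      | succ j ih =>
        intro Φ z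
        rw [pow_succ', mul_apply_eq_comp, hY, ih]
        ring
    obtain ⟨s, C, hC, h⟩ := hb
    obtain ⟨s', C', hC', h'⟩ := exists_sup_seminorm_comp_le (Y ^ k) s
    refine ⟨s ∪ s', C + C * C', by positivity, fun Φ z => ?_⟩
    rw [norm_iteratedFDeriv_zero]
    have e1 : ‖z‖ ^ (2 * k) * ‖T Φ z‖ = ‖T ((Y ^ k) Φ) z‖ := by
      rw [hYk, norm_mul, norm_pow, Complex.norm_real, norm_norm]
    have e2 : ‖z‖ ^ k ≤ 1 + ‖z‖ ^ (2 * k) := by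
      rw [mul_comm 2 k, pow_mul]; nlinarith [sq_nonneg (‖z‖ ^ k - 1), sq_nonneg (‖z‖ ^ k)]
    have m1 : s.sup (schwartzSeminormFamily ℂ V ℂ) Φ ≤
        (s ∪ s').sup (schwartzSeminormFamily ℂ V ℂ) Φ :=
      Finset.sup_mono (f := schwartzSeminormFamily ℂ V ℂ) Finset.subset_union_left Φ
    have m2 : s'.sup (schwartzSeminormFamily ℂ V ℂ) Φ ≤
        (s ∪ s').sup (schwartzSeminormFamily ℂ V ℂ) Φ :=
      Finset.sup_mono (f := schwartzSeminormFamily ℂ V ℂ) Finset.subset_union_right Φ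
    calc ‖z‖ ^ k * ‖T Φ z‖ ≤ (1 + ‖z‖ ^ (2 * k)) * ‖T Φ z‖ := by gcongr
      _ = ‖T Φ z‖ + ‖T ((Y ^ k) Φ) z‖ := by rw [add_mul, one_mul, e1]
      _ ≤ C * (s ∪ s').sup (schwartzSeminormFamily ℂ V ℂ) Φ +
          C * (C' * (s ∪ s').sup (schwartzSeminormFamily ℂ V ℂ) Φ) := by
        refine add_le_add ((h Φ z).trans (by gcongr)) ((h _ z).trans ?_)
        gcongr
        exact (h' Φ).trans (by gcongr)
      _ = _ := by ring
  | succ n ih =>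
    obtain ⟨s, C, hC, h⟩ := ih
    choose s' C' hC' h' using fun i => exists_sup_seminorm_comp_le (D (b i)) s
    let Λ : Fin (Module.finrank ℝ W) → ℂ →L[ℝ] (W →L[ℝ] ℂ) := fun i =>
      ContinuousLinearMap.smulRightL ℝ W ℂ (innerSL ℝ (b i))
    have hfd : ∀ Φ, fderiv ℝ (T Φ) = fun z => ∑ i, (Λ i ∘ T (D (b i) Φ)) z := by
      intro Φ
      ext z m
      obtain ⟨L, hL, hLm⟩ := hD Φ z
      rw [hL.fderiv]
      conv_lhs => rw [← b.sum_repr' m]; simp only [map_sum, map_smul]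
      simp only [hLm]
      simp [Λ]
    refine ⟨Finset.univ.sup s', ∑ i, ‖Λ i‖ * (C * C' i),
      Finset.sum_nonneg fun i _ => by have := hC' i; positivity, fun Φ z => ?_⟩
    rw [← norm_iteratedFDeriv_fderiv, hfd, iteratedFDeriv_fun_sum_apply, Finset.sum_mul]
    · calc ‖z‖ ^ k * ‖∑ i, iteratedFDeriv ℝ n (Λ i ∘ T (D (b i) Φ)) z‖
          ≤ ‖z‖ ^ k * ∑ i, ‖Λ i‖ * ‖iteratedFDeriv ℝ n (T (D (b i) Φ)) z‖ := by
            gcongr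
            refine (norm_sum_le _ _).trans (Finset.sum_le_sum fun i _ => ?_)
            exact (Λ i).norm_iteratedFDeriv_comp_left (N := ∞) (hsm _).contDiffAt
              (mod_cast le_top)
        _ = ∑ i, ‖Λ i‖ * (‖z‖ ^ k * ‖iteratedFDeriv ℝ n (T (D (b i) Φ)) z‖) := by
            rw [Finset.mul_sum]; exact Finset.sum_congr rfl fun i _ => by ring
        _ ≤ _ := by
            refine Finset.sum_le_sum fun i _ => ?_
            rw [mul_assoc]
            refine mul_le_mul_of_nonneg_left ((h _ z).trans ?_) (by positivity)
            rw [mul_assoc]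
            refine mul_le_mul_of_nonneg_left ((h' i Φ).trans ?_) hC
            refine mul_le_mul_of_nonneg_left ?_ (hC' i)
            exact Finset.sup_mono (f := schwartzSeminormFamily ℂ V ℂ)
              (Finset.le_sup (f := s') (Finset.mem_univ i)) Φ
    · intro i _
      exact ((Λ i).contDiff.comp (hsm _)).contDiffAt.of_le (mod_cast le_top)

/-- A continuous linear map between Schwartz spaces, from a family of functions that is bounded by
Schwartz seminorms and intertwines derivatives and multiplication by coordinates. -/
def mkIntertwining (T : 𝓢(V, ℂ) → W → ℂ)
    (hb : ∃ (s : Finset (ℕ × ℕ)) (C : ℝ), 0 ≤ C ∧ ∀ (Φ : 𝓢(V, ℂ)) (z : W),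
      ‖T Φ z‖ ≤ C * s.sup (schwartzSeminormFamily ℂ V ℂ) Φ)
    (hadd : ∀ (Φ Ψ : 𝓢(V, ℂ)) z, T (Φ + Ψ) z = T Φ z + T Ψ z)
    (hsmul : ∀ (a : ℂ) (Φ : 𝓢(V, ℂ)) z, T (a • Φ) z = a • T Φ z)
    (D : W → 𝓢(V, ℂ) →L[ℂ] 𝓢(V, ℂ))
    (hD : ∀ Φ z, ∃ L : W →L[ℝ] ℂ, HasFDerivAt (T Φ) L z ∧ ∀ m, L m = T (D m Φ) z)
    (X : W → 𝓢(V, ℂ) →L[ℂ] 𝓢(V, ℂ))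
    (hX : ∀ m Φ z, T (X m Φ) z = (inner ℝ m z : ℝ) * T Φ z) :
    𝓢(V, ℂ) →L[ℂ] 𝓢(W, ℂ) :=
  SchwartzMap.mkCLM T hadd hsmul (contDiff_of_intertwining T D hD)
    (decay_of_intertwining T hb hadd D hD X hX)

/-- Second order Taylor estimate for all iterated derivatives. -/
theorem norm_iteratedFDeriv_taylor_le {V F : Type} [NormedAddCommGroup V] [NormedSpace ℝ V]
    [NormedAddCommGroup F] [NormedSpace ℝ F] (n : ℕ) (f : V → F) (hf : ContDiff ℝ ∞ f)
    (z h : V) (C : ℝ) (hC : ∀ w ∈ segment ℝ z (z + h), ‖iteratedFDeriv ℝ (n + 2) f w‖ ≤ C) :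
    ‖iteratedFDeriv ℝ n (fun w => f (w + h) - f w - fderiv ℝ f w h) z‖ ≤ C * ‖h‖ * ‖h‖ := by
  induction n generalizing F with
  | zero =>
    rw [norm_iteratedFDeriv_zero]
    have hf' : ContDiff ℝ ∞ (fderiv ℝ f) := (contDiff_infty_iff_fderiv.1 hf).2
    have hd : Differentiable ℝ f := (contDiff_infty_iff_fderiv.1 hf).1
    have hd' : Differentiable ℝ (fderiv ℝ f) := (contDiff_infty_iff_fderiv.1 hf').1
    have hC0 : 0 ≤ C := (norm_nonneg _).trans (hC z (left_mem_segment ℝ _ _))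
    have key : ∀ w ∈ segment ℝ z (z + h), ‖fderiv ℝ f w - fderiv ℝ f z‖ ≤ C * ‖h‖ := by
      intro w hw
      have := (convex_segment z (z + h)).norm_image_sub_le_of_norm_hasFDerivWithin_le
        (f := fderiv ℝ f) (f' := fderiv ℝ (fderiv ℝ f)) (C := C)
        (fun x _ => (hd' x).hasFDerivAt.hasFDerivWithinAt)
        (fun x hx => by
          have := hC x hx
          rw [← norm_iteratedFDeriv_fderiv, ← norm_iteratedFDeriv_fderiv,
            norm_iteratedFDeriv_zero] at this
          exact this) (left_mem_segment ℝ _ _) hw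
      refine this.trans ?_
      gcongr
      have hh := norm_sub_le_of_mem_segment hw
      simpa using hh
    have := (convex_segment z (z + h)).norm_image_sub_le_of_norm_hasFDerivWithin_le'
      (f := f) (f' := fderiv ℝ f) (φ := fderiv ℝ f z)
      (fun x _ => (hd x).hasFDerivAt.hasFDerivWithinAt) key (left_mem_segment ℝ _ _)
      (right_mem_segment ℝ _ _)
    simpa using this
  | succ n ih =>
    have hf' : ContDiff ℝ ∞ (fderiv ℝ f) := (contDiff_infty_iff_fderiv.1 hf).2
    have hd : Differentiable ℝ f := (contDiff_infty_iff_fderiv.1 hf).1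
    have hd' : Differentiable ℝ (fderiv ℝ f) := (contDiff_infty_iff_fderiv.1 hf').1
    rw [← norm_iteratedFDeriv_fderiv]
    have e : fderiv ℝ (fun w => f (w + h) - f w - fderiv ℝ f w h) =
        fun w => fderiv ℝ f (w + h) - fderiv ℝ f w - fderiv ℝ (fderiv ℝ f) w h := by
      ext w m
      have h1 : HasFDerivAt (fun w => f (w + h)) (fderiv ℝ f (w + h)) w := by
        exact (hasFDerivAt_comp_add_right h).2 (hd (w + h)).hasFDerivAt
      have h3 : HasFDerivAt (fun w => fderiv ℝ f w h) ((fderiv ℝ (fderiv ℝ f) w).flip h) w := by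
        have := (hd' w).hasFDerivAt.clm_apply (hasFDerivAt_const h w)
        simpa using this
      rw [((h1.fun_sub (hd w).hasFDerivAt).fun_sub h3).fderiv]
      have hs : IsSymmSndFDerivAt ℝ f w :=
        hf.contDiffAt.isSymmSndFDerivAt (by simpa using ENat.LEInfty.out)
      simp [hs m h]
    rw [e]
    refine ih (fderiv ℝ f) hf' fun w hw => ?_
    rw [norm_iteratedFDeriv_fderiv]
    exact hC w hw

/-- Translating a Schwartz function is differentiable in the translation parameter, when tested
against a continuous linear functional. -/
theorem hasFDerivAt_translate [FiniteDimensional ℝ V] (G : 𝓢(V, ℂ) →L[ℂ] ℂ) (Φ : 𝓢(V, ℂ)) :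
    ∃ L : V →L[ℝ] ℂ, HasFDerivAt (fun a : V => G (Φ.compSubConstCLM ℂ (-a))) L 0 ∧
      ∀ m, L m = G (∂_{m} Φ) := by
  let L : V →ₗ[ℝ] ℂ :=
    { toFun := fun m => G (∂_{m} Φ)
      map_add' := fun m m' => by rw [LineDeriv.lineDerivOp_left_add, map_add]
      map_smul' := fun r m => by
        rw [LineDeriv.lineDerivOp_left_smul]
        have : r • (∂_{m} Φ) = (r : ℂ) • (∂_{m} Φ) := by ext; simp
        rw [this, map_smul]; simp }
  refine ⟨LinearMap.toContinuousLinearMap L, ?_, fun m => rfl⟩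
  obtain ⟨s, C, hC, h⟩ := exists_norm_le_sup_seminorm G
  have key : ∀ i : ℕ × ℕ, ∃ B : ℝ, 0 ≤ B ∧ ∀ a : V, ‖a‖ ≤ 1 →
      schwartzSeminormFamily ℂ V ℂ i (Φ.compSubConstCLM ℂ (-a) - Φ - ∂_{a} Φ) ≤
        B * ‖a‖ * ‖a‖ := by
    rintro ⟨k, n⟩
    let S := 2 ^ k * (Finset.Iic (k, n + 2)).sup (fun m => SchwartzMap.seminorm ℂ m.1 m.2) Φ
    have hS : 0 ≤ S := by positivity
    refine ⟨S, hS, fun a ha => ?_⟩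
    rw [schwartzSeminormFamily_apply]
    refine SchwartzMap.seminorm_le_bound ℂ k n _ (by positivity) fun z => ?_
    by_cases hz : ‖z‖ ^ k = 0
    · rw [hz, zero_mul]; positivity
    have hz' : 0 < ‖z‖ ^ k := lt_of_le_of_ne (by positivity) (Ne.symm hz)
    have hcoe : ⇑(Φ.compSubConstCLM ℂ (-a) - Φ - ∂_{a} Φ) =
        fun w => Φ (w + a) - Φ w - fderiv ℝ Φ w a := by
      ext w
      simp [SchwartzMap.lineDerivOp_apply_eq_fderiv]
    rw [hcoe]
    have := norm_iteratedFDeriv_taylor_le n Φ (Φ.smooth ⊤) z a (S / ‖z‖ ^ k) fun w hw => by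
      rw [le_div_iff₀ hz', mul_comm]
      refine le_trans ?_ (SchwartzMap.one_add_le_sup_seminorm_apply (𝕜 := ℂ) (m := (k, n + 2))
        le_rfl le_rfl Φ w)
      gcongr
      have hh := norm_sub_le_of_mem_segment hw
      have : ‖z‖ ≤ ‖w‖ + ‖w - z‖ := by
        have := norm_sub_le w (w - z); simpa using this
      simp at hh
      linarith
    calc _ ≤ ‖z‖ ^ k * (S / ‖z‖ ^ k * ‖a‖ * ‖a‖) := by gcongr
      _ = _ := by field_simp
  choose B hB hB' using key
  rw [hasFDerivAt_iff_isLittleO_nhds_zero]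
  refine Asymptotics.IsBigO.trans_isLittleO (g := fun a : V => ‖a‖ ^ 2) ?_ ?_
  · refine Asymptotics.IsBigO.of_bound (C * ∑ i ∈ s, B i) ?_
    filter_upwards [Metric.closedBall_mem_nhds (0 : V) one_pos] with a ha
    rw [mem_closedBall_zero_iff] at ha
    have e : G (Φ.compSubConstCLM ℂ (-(0 + a))) - G (Φ.compSubConstCLM ℂ (-0)) -
        (LinearMap.toContinuousLinearMap L) a =
        G (Φ.compSubConstCLM ℂ (-a) - Φ - ∂_{a} Φ) := by
      rw [map_sub, map_sub]; simp [L]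
    rw [e]
    refine (h _).trans ?_
    rw [mul_assoc]
    gcongr
    have hsum : 0 ≤ ∑ i ∈ s, B i := Finset.sum_nonneg fun i _ => hB i
    refine Seminorm.finset_sup_apply_le (by positivity) fun i hi => (hB' i a ha).trans ?_
    rw [norm_pow, norm_norm, mul_assoc, ← sq]
    gcongr
    exact Finset.single_le_sum (fun i _ => hB i) hi
  · have := Asymptotics.isLittleO_norm_pow_id (E' := V) (one_lt_two)
    exact this

end Aux

/-- The Euclidean space `ℝ^d`. -/
abbrev Rd (d : ℕ) : Type := EuclideanSpace ℝ (Fin d)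

/-- The Euclidean space `ℝ^{2d}`, with coordinates split into two blocks of length `d`. -/
abbrev Rdd (d : ℕ) : Type := EuclideanSpace ℝ (Fin d ⊕ Fin d)

section Coordinates

variable {d : ℕ}

/-- The first block `x` of `(x, y) ∈ ℝ^{2d}`. -/
def fstL : Rdd d →L[ℝ] Rd d :=
  LinearMap.toContinuousLinearMap
    { toFun := fun z => WithLp.toLp 2 fun i => z (Sum.inl i)
      map_add' := fun _ _ => rfl
      map_smul' := fun _ _ => rfl }

/-- The second block `y` of `(x, y) ∈ ℝ^{2d}`. -/
def sndL : Rdd d →L[ℝ] Rd d :=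
  LinearMap.toContinuousLinearMap
    { toFun := fun z => WithLp.toLp 2 fun i => z (Sum.inr i)
      map_add' := fun _ _ => rfl
      map_smul' := fun _ _ => rfl }

@[simp]
theorem fstL_apply (z : Rdd d) (i : Fin d) : fstL z i = z (Sum.inl i) := rfl

@[simp]
theorem sndL_apply (z : Rdd d) (i : Fin d) : sndL z i = z (Sum.inr i) := rfl

/-- The embedding `x ↦ (x, 0)`. -/
def inlL : Rd d →L[ℝ] Rdd d :=
  LinearMap.toContinuousLinearMap
    { toFun := fun x => WithLp.toLp 2 (Sum.elim x 0)
      map_add' := fun _ _ => by ext i; rcases i with i | i <;> simp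
      map_smul' := fun _ _ => by ext i; rcases i with i | i <;> simp }

/-- The embedding `y ↦ (0, y)`. -/
def inrL : Rd d →L[ℝ] Rdd d :=
  LinearMap.toContinuousLinearMap
    { toFun := fun y => WithLp.toLp 2 (Sum.elim 0 y)
      map_add' := fun _ _ => by ext i; rcases i with i | i <;> simp
      map_smul' := fun _ _ => by ext i; rcases i with i | i <;> simp }

/-- The point `(x, y) ∈ ℝ^{2d}`. -/
def pair (x y : Rd d) : Rdd d := WithLp.toLp 2 (Sum.elim x y)

theorem pair_eq (x y : Rd d) : pair x y = inlL x + inrL y := by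
  ext i; rcases i with i | i <;> simp [pair, inlL, inrL]

theorem fstL_pair (x y : Rd d) : fstL (pair x y) = x := by
  ext i; simp [pair]

theorem sndL_pair (x y : Rd d) : sndL (pair x y) = y := by
  ext i; simp [pair]

theorem pair_fstL_sndL (z : Rdd d) : pair (fstL z) (sndL z) = z := by
  ext i; rcases i with i | i <;> simp [pair]

theorem inner_eq_add (z w : Rdd d) :
    (inner ℝ z w : ℝ) = inner ℝ (fstL z) (fstL w) + inner ℝ (sndL z) (sndL w) := by
  simp [PiLp.inner_apply, Fintype.sum_sum_type]

theorem norm_sq_pair (x y : Rd d) : ‖pair x y‖ ^ 2 = ‖x‖ ^ 2 + ‖y‖ ^ 2 := by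
  simp only [← real_inner_self_eq_norm_sq, inner_eq_add, fstL_pair, sndL_pair]

theorem norm_snd_le_pair (x y : Rd d) : ‖y‖ ≤ ‖pair x y‖ := by
  refine le_of_sq_le_sq ?_ (norm_nonneg _)
  rw [norm_sq_pair]; nlinarith [sq_nonneg ‖x‖]

theorem norm_inrL_apply (y : Rd d) : ‖inrL y‖ = ‖y‖ := by
  have h : inrL y = pair 0 y := by rw [pair_eq]; simp
  have := norm_sq_pair 0 y
  rw [← h, norm_zero, zero_pow two_ne_zero, zero_add] at this
  exact (sq_eq_sq₀ (norm_nonneg _) (norm_nonneg _)).1 this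

theorem norm_inrL_le : ‖(inrL : Rd d →L[ℝ] Rdd d)‖ ≤ 1 :=
  ContinuousLinearMap.opNorm_le_bound _ zero_le_one fun y => by rw [norm_inrL_apply, one_mul]

end Coordinates

section Slice

variable {d : ℕ}

/-- The section `Φ_x(y) = Φ(x, y)` of a Schwartz function on `ℝ^{2d}`. -/
def slice (x : Rd d) : 𝓢(Rdd d, ℂ) →L[ℂ] 𝓢(Rd d, ℂ) :=
  SchwartzMap.compCLMOfAntilipschitz ℂ (K := 1) (g := fun y => pair x y)
    (by simp only [pair_eq]; fun_prop)
    (AntilipschitzWith.of_le_mul_dist fun y y' => by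
      simp [pair_eq, dist_eq_norm, ← map_sub, norm_inrL_apply])

@[simp]
theorem slice_apply (x : Rd d) (Φ : 𝓢(Rdd d, ℂ)) (y : Rd d) : slice x Φ y = Φ (pair x y) := rfl

theorem norm_iteratedFDeriv_slice_le (x : Rd d) (Φ : 𝓢(Rdd d, ℂ)) (n : ℕ) (y : Rd d) :
    ‖iteratedFDeriv ℝ n (slice x Φ) y‖ ≤ ‖iteratedFDeriv ℝ n Φ (pair x y)‖ := by
  have e : ⇑(slice x Φ) = (fun w => Φ (inlL x + w)) ∘ inrL := by
    ext y; simp [pair_eq]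
  have hc : ContDiff ℝ ∞ fun w => Φ (inlL x + w) :=
    (Φ.smooth ⊤).comp (contDiff_const.add contDiff_id)
  rw [e, ContinuousLinearMap.iteratedFDeriv_comp_right _ hc _ (n := ((⊤ : ℕ∞) : ℕ∞ω)) (i := n) (mod_cast le_top),
    iteratedFDeriv_comp_add_left, ← pair_eq]
  refine (ContinuousMultilinearMap.norm_compContinuousLinearMap_le _ _).trans ?_
  refine mul_le_of_le_one_right (norm_nonneg _) ?_
  simp only [Finset.prod_const]
  exact pow_le_one₀ (norm_nonneg _) norm_inrL_le

theorem seminorm_slice_le (s : Finset (ℕ × ℕ)) (x : Rd d) (Φ : 𝓢(Rdd d, ℂ)) :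
    s.sup (schwartzSeminormFamily ℂ (Rd d) ℂ) (slice x Φ) ≤
      s.sup (schwartzSeminormFamily ℂ (Rdd d) ℂ) Φ := by
  refine Seminorm.finset_sup_apply_le (apply_nonneg _ _) fun i hi => ?_
  refine le_trans ?_ (Seminorm.le_finset_sup_apply hi)
  obtain ⟨k, n⟩ := i
  simp only [schwartzSeminormFamily_apply]
  refine SchwartzMap.seminorm_le_bound ℂ k n _ (apply_nonneg _ _) fun y => ?_
  refine le_trans ?_ (SchwartzMap.le_seminorm ℂ k n Φ (pair x y))
  gcongr
  · exact norm_snd_le_pair x y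
  · exact norm_iteratedFDeriv_slice_le x Φ n y

/-- Multiplication of a Schwartz function by the linear form `⟨m, ·⟩`. -/
def mulInner {V : Type} [NormedAddCommGroup V] [InnerProductSpace ℝ V] (m : V) :
    𝓢(V, ℂ) →L[ℂ] 𝓢(V, ℂ) :=
  SchwartzMap.smulLeftCLM ℂ fun z => ((inner ℝ m z : ℝ) : ℂ)

@[simp]
theorem mulInner_apply {V : Type} [NormedAddCommGroup V] [InnerProductSpace ℝ V] (m : V)
    (Φ : 𝓢(V, ℂ)) (z : V) : mulInner m Φ z = (inner ℝ m z : ℝ) * Φ z := by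
  have h : Function.HasTemperateGrowth fun z : V => ((inner ℝ m z : ℝ) : ℂ) :=
    (Complex.ofRealCLM.comp (innerSL ℝ m)).hasTemperateGrowth
  simp [mulInner, h]

theorem hasFDerivAt_apply_slice (g : 𝓢(Rd d, ℂ) →L[ℂ] ℂ) (Φ : 𝓢(Rdd d, ℂ)) (x : Rd d) :
    ∃ L : Rd d →L[ℝ] ℂ, HasFDerivAt (fun x => g (slice x Φ)) L x ∧
      ∀ m, L m = g (slice x (∂_{inlL m} Φ)) := by
  obtain ⟨L, hL, hLm⟩ := hasFDerivAt_translate (g.comp (slice x)) Φ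
  refine ⟨L.comp inlL, ?_, fun m => hLm _⟩
  have h1 : HasFDerivAt (fun x' : Rd d => inlL (x' - x)) (inlL : Rd d →L[ℝ] Rdd d) x :=
    inlL.hasFDerivAt.comp x ((hasFDerivAt_id x).sub_const x)
  have h2 : HasFDerivAt (fun a : Rdd d => (g.comp (slice x)) (Φ.compSubConstCLM ℂ (-a))) L
      (inlL (x - x)) := by simpa using hL
  refine (h2.comp x h1).congr_of_eventuallyEq (Filter.Eventually.of_forall fun x' => ?_)
  simp only [Function.comp_apply, ContinuousLinearMap.comp_apply]
  congr 1
  ext y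
  simp [pair_eq, add_comm]

/-- For a tempered distribution `g` on `ℝ^d` and a Schwartz function `Φ` on `ℝ^{2d}`, the Schwartz
function `x ↦ ⟨g, Φ_x⟩`. -/
def applySlice (g : 𝓢'(Rd d, ℂ)) : 𝓢(Rdd d, ℂ) →L[ℂ] 𝓢(Rd d, ℂ) :=
  mkIntertwining (fun Φ x => g (slice x Φ))
    (by
      obtain ⟨s, C, hC, h⟩ := exists_norm_le_sup_seminorm (V := Rd d) g
      exact ⟨s, C, hC, fun Φ x => (h _).trans (by gcongr; exact seminorm_slice_le s x Φ)⟩)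
    (fun Φ Ψ x => by simp only [map_add])
    (fun a Φ x => by simp only [map_smul])
    (fun m => LineDeriv.lineDerivOpCLM ℂ 𝓢(Rdd d, ℂ) (inlL m))
    (fun Φ x => hasFDerivAt_apply_slice g Φ x)
    (fun m => mulInner (inlL m))
    (fun m Φ x => by
      have : slice x (mulInner (inlL m) Φ) = ((inner ℝ m x : ℝ) : ℂ) • slice x Φ := by
        ext y
        have h1 : inlL m = pair m 0 := by simp [pair_eq]
        simp [h1, inner_eq_add, fstL_pair, sndL_pair]
      rw [this, map_smul, smul_eq_mul])

@[simp]
theorem applySlice_apply (g : 𝓢'(Rd d, ℂ)) (Φ : 𝓢(Rdd d, ℂ)) (x : Rd d) :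
    applySlice g Φ x = g (slice x Φ) := rfl

/-- The tensor product `f ⊗ g` of tempered distributions: `⟨f ⊗ g, Φ⟩ = ⟨f, x ↦ ⟨g, Φ_x⟩⟩`. -/
def tensor (f g : 𝓢'(Rd d, ℂ)) : 𝓢'(Rdd d, ℂ) :=
  PointwiseConvergenceCLM.precomp ℂ (applySlice g) f

end Slice

section PartialFourier

variable {d : ℕ}

open Complex in
theorem hasFDerivAt_fourier_slice (Φ : 𝓢(Rdd d, ℂ)) (z : Rdd d) :
    ∃ L : Rdd d →L[ℝ] ℂ, HasFDerivAt (fun z => 𝓕 (slice (fstL z) Φ) (sndL z)) L z ∧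
      ∀ m, L m = 𝓕 (slice (fstL z) (∂_{inlL (fstL m)} Φ -
        (2 * Real.pi * I) • mulInner (inrL (sndL m)) Φ)) (sndL z) := by
  let ℓ : Rd d → Rdd d →L[ℝ] ℂ := fun y =>
    (-(2 * Real.pi * I)) • (Complex.ofRealCLM.comp ((innerSL ℝ y).comp sndL))
  have hℓ : ∀ y w, ℓ y w = ((-2 * Real.pi * inner ℝ y (sndL w) : ℝ) : ℂ) * I := by
    intro y w
    simp [ℓ]; ring
  have hexp : ∀ y w, ‖cexp (ℓ y w)‖ = 1 := by
    intro y w; rw [hℓ, norm_exp_ofReal_mul_I]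
  have hF : ∀ (Ψ : 𝓢(Rdd d, ℂ)) w, 𝓕 (slice (fstL w) Ψ) (sndL w) =
      ∫ y, cexp (ℓ y w) * Ψ (pair (fstL w) y) := by
    intro Ψ w
    rw [SchwartzMap.fourier_coe, Real.fourier_eq']
    simp only [hℓ, smul_eq_mul, slice_apply]
  let F' : Rdd d → Rd d → Rdd d →L[ℝ] ℂ := fun w y =>
    cexp (ℓ y w) • ((fderiv ℝ Φ (pair (fstL w) y)).comp (inlL.comp fstL)) +
      Φ (pair (fstL w) y) • (cexp (ℓ y w) • ℓ y)
  have hdiff : ∀ w y, HasFDerivAt (fun w => cexp (ℓ y w) * Φ (pair (fstL w) y)) (F' w y) w := by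
    intro w y
    have h1 : HasFDerivAt (fun w => cexp (ℓ y w)) (cexp (ℓ y w) • ℓ y) w :=
      (ℓ y).hasFDerivAt.cexp
    have h2 : HasFDerivAt (fun w : Rdd d => Φ (pair (fstL w) y))
        ((fderiv ℝ Φ (pair (fstL w) y)).comp (inlL.comp fstL)) w := by
      refine HasFDerivAt.comp (g := Φ) (f := fun w : Rdd d => pair (fstL w) y) w
        (Φ.hasFDerivAt _) ?_
      simp only [pair_eq]
      exact ((inlL.comp fstL).hasFDerivAt).add_const _
    exact h1.mul h2
  have cont_pair : Continuous fun y : Rd d => pair (fstL z) y := by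
    simp only [pair_eq]; fun_prop
  have contℓ : Continuous ℓ := by
    simp only [ℓ]; fun_prop
  have contexp : ∀ w, Continuous fun y => cexp (ℓ y w) := by
    intro w; fun_prop
  have contfd : Continuous (fderiv ℝ Φ) := (SchwartzMap.fderivCLM ℝ (Rdd d) ℂ Φ).continuous
  have contF' : Continuous (F' z) := by
    have := contexp z
    have h3 : Continuous fun y : Rd d => fderiv ℝ Φ (pair (fstL z) y) := contfd.comp cont_pair
    have h4 : Continuous fun y : Rd d => Φ (pair (fstL z) y) := Φ.continuous.comp cont_pair
    simp only [F']
    exact (this.smul (h3.clm_comp continuous_const)).add (h4.smul (this.smul contℓ))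
  let N := (volume : Measure (Rd d)).integrablePower
  have hint := Measure.integrable_pow_neg_integrablePower (volume : Measure (Rd d))
  let S := 2 ^ (N + 1) * (Finset.Iic (N + 1, 1)).sup
    (fun m => SchwartzMap.seminorm ℂ m.1 m.2) Φ
  have hS : ∀ n ≤ 1, ∀ (w : Rdd d) (y : Rd d),
      (1 + ‖y‖) ^ (N + 1) * ‖iteratedFDeriv ℝ n Φ (pair (fstL w) y)‖ ≤ S := by
    intro n hn w y
    refine le_trans ?_ (SchwartzMap.one_add_le_sup_seminorm_apply (𝕜 := ℂ) (m := (N + 1, 1))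
      le_rfl hn Φ (pair (fstL w) y))
    gcongr
    exact norm_snd_le_pair _ _
  have hS0 : 0 ≤ S := by positivity
  let A := ‖(inlL.comp fstL : Rdd d →L[ℝ] Rdd d)‖
  let B := ‖(sndL : Rdd d →L[ℝ] Rd d)‖
  have hbound : ∀ y w, ‖F' w y‖ ≤ (S * A + S * (2 * Real.pi * B)) * (1 + ‖y‖) ^ (-(N : ℝ)) := by
    intro y w
    have hy : 0 < (1 + ‖y‖) ^ N := by positivity
    rw [Real.rpow_neg (by positivity), Real.rpow_natCast, ← div_eq_mul_inv, le_div_iff₀ hy]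
    have e0 := hS 0 zero_le_one w y
    have e1 := hS 1 le_rfl w y
    rw [norm_iteratedFDeriv_zero] at e0
    rw [norm_iteratedFDeriv_one] at e1
    have hℓn : ‖ℓ y‖ ≤ 2 * Real.pi * (‖y‖ * B) := by
      refine ContinuousLinearMap.opNorm_le_bound _ (by positivity) fun m => ?_
      rw [hℓ, norm_mul, norm_I, mul_one, Complex.norm_real, norm_mul, norm_mul, Real.norm_eq_abs,
        abs_neg, abs_two, Real.norm_eq_abs, abs_of_pos Real.pi_pos, mul_assoc (2 * Real.pi),
        mul_assoc ‖y‖]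
      refine mul_le_mul_of_nonneg_left ?_ (by positivity)
      exact (norm_inner_le_norm _ _).trans (by gcongr; exact sndL.le_opNorm m)
    have n1 : ‖F' w y‖ ≤ ‖fderiv ℝ Φ (pair (fstL w) y)‖ * A +
        ‖Φ (pair (fstL w) y)‖ * (2 * Real.pi * (‖y‖ * B)) := by
      refine (norm_add_le _ _).trans (add_le_add ?_ ?_)
      · rw [norm_smul, hexp, one_mul]
        exact ContinuousLinearMap.opNorm_comp_le _ _
      · rw [norm_smul, norm_smul, hexp, one_mul]
        gcongr
    have n2 : (1 + ‖y‖) ^ N ≤ (1 + ‖y‖) ^ (N + 1) :=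
      pow_le_pow_right₀ (by linarith [norm_nonneg y]) (Nat.le_succ N)
    have n3 : ‖y‖ * (1 + ‖y‖) ^ N ≤ (1 + ‖y‖) ^ (N + 1) := by
      rw [pow_succ']; gcongr; linarith
    calc ‖F' w y‖ * (1 + ‖y‖) ^ N
        ≤ (‖fderiv ℝ Φ (pair (fstL w) y)‖ * A +
          ‖Φ (pair (fstL w) y)‖ * (2 * Real.pi * (‖y‖ * B))) * (1 + ‖y‖) ^ N := by gcongr
      _ = ((1 + ‖y‖) ^ N * ‖fderiv ℝ Φ (pair (fstL w) y)‖) * A +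
          ((‖y‖ * (1 + ‖y‖) ^ N) * ‖Φ (pair (fstL w) y)‖) * (2 * Real.pi * B) := by ring
      _ ≤ ((1 + ‖y‖) ^ (N + 1) * ‖fderiv ℝ Φ (pair (fstL w) y)‖) * A +
          ((1 + ‖y‖) ^ (N + 1) * ‖Φ (pair (fstL w) y)‖) * (2 * Real.pi * B) := by gcongr
      _ ≤ S * A + S * (2 * Real.pi * B) := by gcongr
  have hint' : Integrable fun y : Rd d =>
      (S * A + S * (2 * Real.pi * B)) * (1 + ‖y‖) ^ (-(N : ℝ)) := hint.const_mul _
  have hF'int : Integrable (F' z) :=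
    hint'.mono' contF'.aestronglyMeasurable (Filter.Eventually.of_forall fun y => hbound y z)
  have hmeas : ∀ w, AEStronglyMeasurable (fun y => cexp (ℓ y w) * Φ (pair (fstL w) y))
      (volume : Measure (Rd d)) := by
    intro w
    exact ((contexp w).mul (slice (fstL w) Φ).continuous).aestronglyMeasurable
  have hFint : Integrable (fun y => cexp (ℓ y z) * Φ (pair (fstL z) y))
      (volume : Measure (Rd d)) := by
    refine (slice (fstL z) Φ).integrable.mono (hmeas z) (Filter.Eventually.of_forall fun y => ?_)
    simp [hexp]
  refine ⟨∫ y, F' z y, ?_, fun m => ?_⟩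
  · simp only [hF]
    exact hasFDerivAt_integral_of_dominated_of_fderiv_le Filter.univ_mem
      (Filter.Eventually.of_forall hmeas) hFint contF'.aestronglyMeasurable
      (Filter.Eventually.of_forall fun y w _ => hbound y w) hint'
      (Filter.Eventually.of_forall fun y w _ => hdiff w y)
  · rw [ContinuousLinearMap.integral_apply hF'int, hF]
    refine integral_congr_ae (Filter.Eventually.of_forall fun y => ?_)
    have h1 : inrL (sndL m) = pair 0 (sndL m) := by simp [pair_eq]
    simp [F', hℓ, SchwartzMap.lineDerivOp_apply_eq_fderiv, h1, inner_eq_add, fstL_pair, sndL_pair,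
      real_inner_comm y]
    ring

/-- The partial Fourier transform `ℱ₂Φ(x, ω) = ∫ e^{-2πi ω·y} Φ(x, y) dy` on `𝓢(ℝ^{2d})`, that is,
the Fourier transform of the section `Φ_x` evaluated at `ω`. -/
def partialFourierSchwartz : 𝓢(Rdd d, ℂ) →L[ℂ] 𝓢(Rdd d, ℂ) :=
  mkIntertwining (fun Φ z => 𝓕 (slice (fstL z) Φ) (sndL z))
    (by
      obtain ⟨s, C, hC, h⟩ := exists_sup_seminorm_comp_le
        (FourierTransform.fourierCLM ℂ 𝓢(Rd d, ℂ)) {(0, 0)}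
      refine ⟨s, C, hC, fun Φ z => ?_⟩
      refine (SchwartzMap.norm_le_seminorm ℂ _ _).trans ?_
      have h' := h (slice (fstL z) Φ)
      simp only [Finset.sup_singleton, schwartzSeminormFamily_apply,
        FourierTransform.fourierCLM_apply] at h'
      exact h'.trans (by gcongr; exact seminorm_slice_le s _ Φ))
    (fun Φ Ψ z => by simp only [map_add, FourierTransform.fourier_add, add_apply])
    (fun a Φ z => by simp only [map_smul, FourierTransform.fourier_smul, smul_apply])
    (fun m => LineDeriv.lineDerivOpCLM ℂ 𝓢(Rdd d, ℂ) (inlL (fstL m)) -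
      (2 * Real.pi * Complex.I) • mulInner (inrL (sndL m)))
    (fun Φ z => hasFDerivAt_fourier_slice Φ z)
    (fun m => mulInner (inlL (fstL m)) +
      (2 * Real.pi * Complex.I)⁻¹ • LineDeriv.lineDerivOpCLM ℂ 𝓢(Rdd d, ℂ) (inrL (sndL m)))
    (fun m Φ z => by
      have h1 : slice (fstL z) (mulInner (inlL (fstL m)) Φ) =
          ((inner ℝ (fstL m) (fstL z) : ℝ) : ℂ) • slice (fstL z) Φ := by
        ext y
        have h1 : inlL (fstL m) = pair (fstL m) 0 := by simp [pair_eq]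
        simp [h1, inner_eq_add, fstL_pair, sndL_pair]
      have h2 : slice (fstL z) (∂_{inrL (sndL m)} Φ) = ∂_{sndL m} (slice (fstL z) Φ) := by
        ext y
        rw [slice_apply, SchwartzMap.lineDerivOp_apply_eq_fderiv,
          SchwartzMap.lineDerivOp_apply_eq_fderiv]
        have h3 : HasFDerivAt (slice (fstL z) Φ)
            ((fderiv ℝ Φ (pair (fstL z) y)).comp inrL) y := by
          refine HasFDerivAt.comp (g := Φ) (f := fun y => pair (fstL z) y) y
            (Φ.hasFDerivAt _) ?_
          simp only [pair_eq]
          exact inrL.hasFDerivAt.const_add _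
        rw [h3.fderiv]
        rfl
      have h4 : Function.HasTemperateGrowth fun w : Rd d => inner ℝ w (sndL m) := by fun_prop
      simp only [add_apply, smul_apply, map_add, map_smul,
        FourierTransform.fourier_add, FourierTransform.fourier_smul, h1, LineDeriv.lineDerivOpCLM_apply, h2,
        SchwartzMap.fourier_lineDerivOp_eq, SchwartzMap.smulLeftCLM_apply_apply h4, smul_eq_mul]
      rw [inner_eq_add, real_inner_comm (sndL z)]
      have : (Real.pi : ℂ) ≠ 0 := by exact_mod_cast Real.pi_ne_zero
      rw [Complex.real_smul]
      push_cast
      field_simp)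

@[simp]
theorem partialFourierSchwartz_apply (Φ : 𝓢(Rdd d, ℂ)) (x w : Rd d) :
    partialFourierSchwartz Φ (pair x w) =
      ∫ y, Complex.exp (((-2 * Real.pi * inner ℝ y w : ℝ) : ℂ) * Complex.I) * Φ (pair x y) := by
  change 𝓕 (slice (fstL (pair x w)) Φ) (sndL (pair x w)) = _
  rw [SchwartzMap.fourier_coe, Real.fourier_eq', fstL_pair, sndL_pair]
  simp

/-- The partial Fourier transform `ℱ₂` on `𝓢'(ℝ^{2d})`, defined by duality. -/
def partialFourier : 𝓢'(Rdd d, ℂ) →L[ℂ] 𝓢'(Rdd d, ℂ) :=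
  PointwiseConvergenceCLM.precomp ℂ partialFourierSchwartz

end PartialFourier

section Operations

/-- The complex conjugate `conj φ` of a Schwartz function. -/
def conjS {V : Type} [NormedAddCommGroup V] [NormedSpace ℝ V] :
    𝓢(V, ℂ) →L[ℝ] 𝓢(V, ℂ) :=
  SchwartzMap.postcompCLM (Complex.conjCLE : ℂ →L[ℝ] ℂ)

@[simp]
theorem conjS_apply {V : Type} [NormedAddCommGroup V] [NormedSpace ℝ V] (φ : 𝓢(V, ℂ)) (x : V) :
    conjS φ x = starRingEnd ℂ (φ x) := rfl

/-- The complex conjugate of a tempered distribution: `⟨conj f, φ⟩ = conj ⟨f, conj φ⟩`. -/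
def conjD {V : Type} [NormedAddCommGroup V] [NormedSpace ℝ V] (f : 𝓢'(V, ℂ)) : 𝓢'(V, ℂ) :=
  ContinuousLinearMap.toPointwiseConvergenceCLM ℂ (RingHom.id ℂ) 𝓢(V, ℂ) ℂ
    { toFun := fun φ => starRingEnd ℂ (f (conjS φ))
      map_add' := fun φ ψ => by simp only [map_add]
      map_smul' := fun c φ => by
        have : conjS (c • φ) = starRingEnd ℂ c • conjS φ := by ext x; simp
        rw [this, map_smul]
        simp
      cont := Complex.continuous_conj.comp
        ((ContinuousLinearMap.continuous (f : 𝓢(V, ℂ) →L[ℂ] ℂ)).comp conjS.continuous) }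

variable {d : ℕ}

/-- The linear change of variables of `ℝ^{2d}` given by an invertible matrix. -/
def matEquiv (A : GL (Fin d ⊕ Fin d) ℝ) : Rdd d ≃L[ℝ] Rdd d :=
  LinearEquiv.toContinuousLinearEquiv <| LinearEquiv.ofLinearMap
    (Matrix.toEuclideanLin (A : Matrix (Fin d ⊕ Fin d) (Fin d ⊕ Fin d) ℝ))
    (Matrix.toEuclideanLin ((A⁻¹ : GL (Fin d ⊕ Fin d) ℝ) :
      Matrix (Fin d ⊕ Fin d) (Fin d ⊕ Fin d) ℝ))
    (by
      ext z i
      rw [LinearMap.comp_apply, Matrix.toLpLin_apply, Matrix.toLpLin_apply,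
        Matrix.mulVec_mulVec, ← Units.val_mul, mul_inv_cancel]
      simp)
    (by
      ext z i
      rw [LinearMap.comp_apply, Matrix.toLpLin_apply, Matrix.toLpLin_apply,
        Matrix.mulVec_mulVec, ← Units.val_mul, inv_mul_cancel]
      simp)

/-- The coordinate transformation `u ↦ u ∘ A` on `𝓢'(ℝ^{2d})` for an invertible matrix `A`:
`⟨u ∘ A, φ⟩ = |det A|⁻¹ ⟨u, φ ∘ A⁻¹⟩`. -/
def coordTrans (A : GL (Fin d ⊕ Fin d) ℝ) : 𝓢'(Rdd d, ℂ) →L[ℂ] 𝓢'(Rdd d, ℂ) :=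
  ((|(A : Matrix (Fin d ⊕ Fin d) (Fin d ⊕ Fin d) ℝ).det|⁻¹ : ℝ) : ℂ) •
    PointwiseConvergenceCLM.precomp ℂ
      (SchwartzMap.compCLMOfContinuousLinearEquiv ℂ (matEquiv A).symm)

/-- The canonical symplectic matrix `J = (0, I; -I, 0)`, so that `J (x, y) = (y, -x)`. -/
def symplecticJ (d : ℕ) : GL (Fin d ⊕ Fin d) ℝ where
  val := Matrix.fromBlocks 0 1 (-1) 0
  inv := Matrix.fromBlocks 0 (-1) 1 0
  val_inv := by simp [Matrix.fromBlocks_multiply]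
  inv_val := by simp [Matrix.fromBlocks_multiply]

/-- The symplectic Fourier transform `ℱ_σ u = (ℱ u) ∘ J` on `𝓢'(ℝ^{2d})`. -/
def symplecticFourier (u : 𝓢'(Rdd d, ℂ)) : 𝓢'(Rdd d, ℂ) := coordTrans (symplecticJ d) (𝓕 u)

end Operations

section MatrixWigner

variable {d : ℕ}

/-- The matrix-Wigner distribution `ℬ_A(f, g) = ℱ₂ 𝔗_A (f ⊗ conj g)` of tempered distributions. -/
def matrixWigner (A : GL (Fin d ⊕ Fin d) ℝ) (f g : 𝓢'(Rd d, ℂ)) : 𝓢'(Rdd d, ℂ) :=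
  partialFourier (coordTrans A (tensor f (conjD g)))

/-- The matrix `(I, (1/2)I; I, -(1/2)I)` of the Wigner distribution. -/
def wignerMatrix (d : ℕ) : GL (Fin d ⊕ Fin d) ℝ where
  val := Matrix.fromBlocks 1 ((1 / 2 : ℝ) • 1) 1 (-((1 / 2 : ℝ) • 1))
  inv := Matrix.fromBlocks ((1 / 2 : ℝ) • 1) ((1 / 2 : ℝ) • 1) 1 (-1)
  val_inv := by
    rw [Matrix.fromBlocks_multiply, ← Matrix.fromBlocks_one]
    congr 1 <;> simp [← add_smul] <;> norm_num
  inv_val := by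
    rw [Matrix.fromBlocks_multiply, ← Matrix.fromBlocks_one]
    congr 1 <;> simp [← add_smul] <;> norm_num

/-- The Cohen-type matrix `A_M = (I, M + (1/2)I; I, M - (1/2)I)`. -/
def cohenMatrix (M : Matrix (Fin d) (Fin d) ℝ) : GL (Fin d ⊕ Fin d) ℝ where
  val := Matrix.fromBlocks 1 (M + (1 / 2 : ℝ) • 1) 1 (M - (1 / 2 : ℝ) • 1)
  inv := Matrix.fromBlocks ((1 / 2 : ℝ) • 1 - M) (M + (1 / 2 : ℝ) • 1) 1 (-1)
  val_inv := by
    have h : (1 / 2 : ℝ) • (1 : Matrix (Fin d) (Fin d) ℝ) + (1 / 2 : ℝ) • 1 = 1 := by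
      rw [← add_smul]; norm_num
    rw [Matrix.fromBlocks_multiply, ← Matrix.fromBlocks_one]
    congr 1 <;> simp only [one_mul, mul_one, mul_neg] <;>
      generalize (1 / 2 : ℝ) • (1 : Matrix (Fin d) (Fin d) ℝ) = c at h ⊢
    · rw [← h]; abel
    · abel
    · abel
    · rw [← h]; abel
  inv_val := by
    have h : (1 / 2 : ℝ) • (1 : Matrix (Fin d) (Fin d) ℝ) + (1 / 2 : ℝ) • 1 = 1 := by
      rw [← add_smul]; norm_num
    rw [Matrix.fromBlocks_multiply, ← Matrix.fromBlocks_one]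
    congr 1
    · simp only [mul_one]
      generalize (1 / 2 : ℝ) • (1 : Matrix (Fin d) (Fin d) ℝ) = c at h ⊢
      rw [← h]; abel
    · simp only [add_mul, mul_add, sub_mul, mul_sub, smul_mul_assoc, mul_smul_comm, one_mul,
        mul_one]
      module
    · simp
    · simp only [one_mul, neg_mul]
      generalize (1 / 2 : ℝ) • (1 : Matrix (Fin d) (Fin d) ℝ) = c at h ⊢
      rw [← h]; abel

/-- The Wigner distribution `W f` of a tempered distribution. -/
def wigner (f : 𝓢'(Rd d, ℂ)) : 𝓢'(Rdd d, ℂ) := matrixWigner (wignerMatrix d) f f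

/-- The distribution `ℬ_{A_M} f` of a tempered distribution. -/
def perturbedWigner (M : Matrix (Fin d) (Fin d) ℝ) (f : 𝓢'(Rd d, ℂ)) : 𝓢'(Rdd d, ℂ) :=
  matrixWigner (cohenMatrix M) f f

end MatrixWigner

section Kernel

theorem hasTemperateGrowth_cexp_ofReal_mul_I :
    Function.HasTemperateGrowth fun t : ℝ => Complex.exp (t * Complex.I) := by
  have hd : ∀ t : ℝ, HasDerivAt (fun t : ℝ => Complex.exp (t * Complex.I))
      (Complex.I * Complex.exp (t * Complex.I)) t := by
    intro t
    have h := ((Complex.ofRealCLM.hasDerivAt (x := t)).mul_const Complex.I).cexp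
    simpa [mul_comm] using h
  have hi : ∀ n : ℕ, iteratedDeriv n (fun t : ℝ => Complex.exp (t * Complex.I)) =
      fun t : ℝ => Complex.I ^ n * Complex.exp (t * Complex.I) := by
    intro n
    induction n with
    | zero => simp
    | succ n ih =>
      rw [iteratedDeriv_succ, ih]
      ext t
      rw [((hd t).const_mul (Complex.I ^ n)).deriv]
      ring
  refine ⟨(Complex.ofRealCLM.contDiff.mul contDiff_const).cexp, fun n => ⟨0, 1, fun t => ?_⟩⟩
  rw [norm_iteratedFDeriv_eq_norm_iteratedDeriv, hi]
  simp [Complex.norm_exp_ofReal_mul_I]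

variable {d : ℕ}

/-- The chirp `χ_M(ξ, η) = e^{2πi η·Mξ}` on `ℝ^{2d}`. -/
def chirp (M : Matrix (Fin d) (Fin d) ℝ) (z : Rdd d) : ℂ :=
  Complex.exp (((2 * Real.pi * inner ℝ (sndL z) (Matrix.toEuclideanLin M (fstL z)) : ℝ) : ℂ) *
    Complex.I)

theorem hasTemperateGrowth_chirp (M : Matrix (Fin d) (Fin d) ℝ) :
    Function.HasTemperateGrowth (chirp M) := by
  have h : Function.HasTemperateGrowth fun z : Rdd d =>
      2 * Real.pi * (innerSL ℝ (sndL z) (LinearMap.toContinuousLinearMap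
        (Matrix.toEuclideanLin M) (fstL z)) : ℝ) := by
    refine (Function.HasTemperateGrowth.const _).mul ?_
    exact ContinuousLinearMap.bilinear_hasTemperateGrowth (𝕜 := ℝ) (innerSL ℝ)
      sndL.hasTemperateGrowth
      ((LinearMap.toContinuousLinearMap (Matrix.toEuclideanLin M)).comp fstL).hasTemperateGrowth
  exact hasTemperateGrowth_cexp_ofReal_mul_I.comp h

/-- The Cohen kernel `θ_M = ℱ_σ χ_M`. -/
def theta (M : Matrix (Fin d) (Fin d) ℝ) : 𝓢'(Rdd d, ℂ) :=
  symplecticFourier ((hasTemperateGrowth_chirp M).toTemperedDistribution volume)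

end Kernel

section FunctionSpaces

variable {V : Type} [NormedAddCommGroup V] [InnerProductSpace ℝ V]

/-- The time-frequency shift `π(x, ξ) g (t) = e^{2πi ξ·t} g(t - x)`. -/
def timeFreqShift (x ξ : V) (g : 𝓢(V, ℂ)) : 𝓢(V, ℂ) :=
  SchwartzMap.smulLeftCLM ℂ
    (fun t : V => Complex.exp (((2 * Real.pi * inner ℝ ξ t : ℝ) : ℂ) * Complex.I))
    (g.compSubConstCLM ℂ x)

@[simp]
theorem timeFreqShift_apply (x ξ : V) (g : 𝓢(V, ℂ)) (t : V) :
    timeFreqShift x ξ g t =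
      Complex.exp (((2 * Real.pi * inner ℝ ξ t : ℝ) : ℂ) * Complex.I) * g (t - x) := by
  have h : Function.HasTemperateGrowth fun t : V => 2 * Real.pi * (inner ℝ ξ t : ℝ) :=
    (Function.HasTemperateGrowth.const _).mul (innerSL ℝ ξ).hasTemperateGrowth
  have h' := hasTemperateGrowth_cexp_ofReal_mul_I.comp h
  exact SchwartzMap.smulLeftCLM_apply_apply h' _ _

/-- The short-time Fourier transform `V_g f(x, ξ) = ⟨f, π(x, ξ) g⟩` of a tempered distribution with
respect to the window `g`, where the bracket is conjugate-linear in the second entry. -/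
def stft (g : 𝓢(V, ℂ)) (f : 𝓢'(V, ℂ)) (x ξ : V) : ℂ := f (conjS (timeFreqShift x ξ g))

variable [FiniteDimensional ℝ V] [MeasurableSpace V] [BorelSpace V]

/-- The modulation space `M^{p,q}`, described with the window `g`: the tempered distributions `f`
for which the mixed norm `‖ ξ ↦ ‖V_g f(·, ξ)‖_{L^p} ‖_{L^q}` is finite. -/
def modulationSpace (g : 𝓢(V, ℂ)) (p q : ℝ≥0∞) : Set 𝓢'(V, ℂ) :=
  {f | eLpNorm (fun ξ : V => eLpNorm (fun x : V => stft g f x ξ) p volume) q volume < ⊤}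

/-- The Wiener amalgam space `W(ℱL^p, L^q)`, described with the window `g`: the tempered
distributions `f` for which the mixed norm `‖ x ↦ ‖V_g f(x, ·)‖_{L^p} ‖_{L^q}` is finite. -/
def wienerAmalgam (g : 𝓢(V, ℂ)) (p q : ℝ≥0∞) : Set 𝓢'(V, ℂ) :=
  {f | eLpNorm (fun x : V => eLpNorm (fun ξ : V => stft g f x ξ) p volume) q volume < ⊤}

end FunctionSpaces

end CohenClass

end

open CohenClass SchwartzMap
open scoped ENNReal

/-
With `J` the standard symplectic isometry and `χ = χ_M ∘ J`, the distribution `ℬ_{A_M} f` is the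
Fourier multiplier `χ(D)` applied to `Wf`, and `θ_M` is `χ(D)` applied to `δ₀`. Since `χ` is a
unimodular character of second degree, `χ(ξ + η) = χ(ξ) χ(η) e^{2πi Bξ·η}` with `B` symmetric,
`χ(D)` shears the short-time Fourier transform: `|V_g (χ(D)u)(x, ξ)| = |V_{g'} u(x + Bξ, ξ)|` for
another window `g'`. The shear is a translation in `x` for fixed `ξ`, so it preserves the norm of
`M^{p,q}`, which is independent of the window up to constants. For `u = δ₀` one gets
`|V_g (χ(D)δ₀)(x, ξ)| = |g'(-(x + Bξ))|`, whose integral over `ξ` is finite and independent of `x`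
as soon as `B` is invertible, that is, as soon as `M` is.
-/

noncomputable section

open SchwartzMap MeasureTheory
open scoped ContDiff FourierTransform LineDeriv ENNReal

namespace CohenClass

section Minkowski

variable {α β : Type*} [MeasurableSpace α] [MeasurableSpace β] {μ : Measure α} {ν : Measure β}

theorem eLpNorm_top_le_iff {f : α → ℝ≥0∞} {c : ℝ≥0∞} :
    eLpNorm f ⊤ μ ≤ c ↔ ∀ᵐ x ∂μ, f x ≤ c := by
  simp only [eLpNorm_exponent_top, eLpNormEssSup, enorm_eq_self]
  exact ⟨fun h => (ENNReal.ae_le_essSup f).mono fun x hx => hx.trans h, essSup_le_of_ae_le c⟩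

theorem eLpNorm_const_mul_ennreal {p : ℝ≥0∞} (hp : p ≠ 0) (c : ℝ≥0∞) {f : α → ℝ≥0∞}
    (hf : Measurable f) : eLpNorm (fun x => c * f x) p μ = c * eLpNorm f p μ := by
  rcases eq_or_ne p ⊤ with rfl | hp'
  · exact ENNReal.essSup_const_mul
  have h0 : 0 < p.toReal := ENNReal.toReal_pos hp hp'
  simp only [eLpNorm_eq_lintegral_rpow_enorm_toReal hp hp', enorm_eq_self,
    ENNReal.mul_rpow_of_nonneg _ _ h0.le]
  rw [lintegral_const_mul _ (hf.pow_const _), ENNReal.mul_rpow_of_nonneg _ _ (by positivity),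
    ← ENNReal.rpow_mul, mul_one_div_cancel h0.ne', ENNReal.rpow_one]

theorem lintegral_rpow_le_lintegral_rpow_mul_measure_univ {p : ℝ} (hp : 1 ≤ p) {f : β → ℝ≥0∞}
    (hf : Measurable f) :
    (∫⁻ y, f y ∂ν) ^ p ≤ (∫⁻ y, f y ^ p ∂ν) * ν Set.univ ^ (p - 1) := by
  have hp0 : 0 < p := one_pos.trans_le hp
  have holder := eLpNorm'_le_eLpNorm'_mul_rpow_measure_univ one_pos hp
    (f := f) (μ := ν) hf.aestronglyMeasurable
  simp only [eLpNorm'_eq_lintegral_enorm, enorm_eq_self, ENNReal.rpow_one, div_one] at holder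
  refine (ENNReal.rpow_le_rpow holder hp0.le).trans_eq ?_
  rw [ENNReal.mul_rpow_of_nonneg _ _ hp0.le, ← ENNReal.rpow_mul, ← ENNReal.rpow_mul,
    one_div_mul_cancel hp0.ne', ENNReal.rpow_one, sub_mul, one_mul, one_div_mul_cancel hp0.ne']

variable [SFinite μ]

theorem measurable_eLpNorm_left (p : ℝ≥0∞) {F : α → β → ℝ≥0∞}
    (hF : Measurable (Function.uncurry F)) : Measurable fun y => eLpNorm (fun x => F x y) p μ := by
  rcases eq_or_ne p 0 with rfl | hp
  · simp
  rcases eq_or_ne p ⊤ with rfl | hp'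
  · refine measurable_of_Iic fun c => ?_
    have h (y : β) : y ∈ (fun y => eLpNorm (fun x => F x y) ⊤ μ) ⁻¹' Set.Iic c ↔
        μ ((fun x => (x, y)) ⁻¹' {z | c < F z.1 z.2}) = 0 := by
      simp only [Set.mem_preimage, Set.mem_Iic, eLpNorm_top_le_iff, ae_iff, not_le]
      rfl
    rw [Set.ext h]
    exact measurable_measure_prodMk_right (measurableSet_lt measurable_const hF)
      (measurableSet_singleton 0)
  · simp only [eLpNorm_eq_lintegral_rpow_enorm_toReal hp hp', enorm_eq_self]
    exact (Measurable.lintegral_prod_left' (hF.pow_const _)).pow_const _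

variable [SFinite ν]

theorem eLpNorm_lintegral_le_measure_univ {p : ℝ≥0∞} (hp : 1 ≤ p) {F : α → β → ℝ≥0∞}
    (hF : Measurable (Function.uncurry F)) (h : ∀ᵐ y ∂ν, eLpNorm (fun x => F x y) p μ ≤ 1) :
    eLpNorm (fun x => ∫⁻ y, F x y ∂ν) p μ ≤ ν Set.univ := by
  rcases eq_or_ne p ⊤ with rfl | hp'
  · simp only [eLpNorm_top_le_iff] at h ⊢
    have hS : MeasurableSet {z : α × β | F z.1 z.2 ≤ 1} := measurableSet_le hF measurable_const
    have h' : ∀ᵐ x ∂μ, ∀ᵐ y ∂ν, F x y ≤ 1 := (Measure.ae_ae_comm hS).2 h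
    filter_upwards [h'] with x hx
    simpa using lintegral_mono_ae hx
  have hp0 : p ≠ 0 := (one_pos.trans_le hp).ne'
  have hr0 : 0 < p.toReal := ENNReal.toReal_pos hp0 hp'
  have hr : 1 ≤ p.toReal := by simpa using ENNReal.toReal_mono hp' hp
  simp only [eLpNorm_eq_lintegral_rpow_enorm_toReal hp0 hp', enorm_eq_self, one_div,
    ENNReal.rpow_inv_le_iff hr0, ENNReal.one_rpow] at h ⊢
  have hFr : Measurable (Function.uncurry fun x y => F x y ^ p.toReal) := hF.pow_const _
  have hFr' : Measurable fun x => ∫⁻ y, F x y ^ p.toReal ∂ν := hFr.lintegral_prod_right'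
  calc ∫⁻ x, (∫⁻ y, F x y ∂ν) ^ p.toReal ∂μ
      ≤ ∫⁻ x, (∫⁻ y, F x y ^ p.toReal ∂ν) * ν Set.univ ^ (p.toReal - 1) ∂μ :=
        lintegral_mono fun x => lintegral_rpow_le_lintegral_rpow_mul_measure_univ hr
          (hF.comp measurable_prodMk_left)
    _ = (∫⁻ y, ∫⁻ x, F x y ^ p.toReal ∂μ ∂ν) * ν Set.univ ^ (p.toReal - 1) := by
        rw [lintegral_mul_const _ hFr', lintegral_lintegral_swap hFr.aemeasurable]
    _ ≤ ν Set.univ * ν Set.univ ^ (p.toReal - 1) := by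
        gcongr
        simpa using lintegral_mono_ae h
    _ = ν Set.univ ^ p.toReal := by
        rw [← add_sub_cancel 1 p.toReal, ENNReal.rpow_add_of_nonneg _ _ zero_le_one
          (sub_nonneg.2 hr), ENNReal.rpow_one, add_sub_cancel]

/-- **Minkowski's integral inequality** -/
theorem eLpNorm_lintegral_le {p : ℝ≥0∞} (hp : 1 ≤ p) {F : α → β → ℝ≥0∞}
    (hF : Measurable (Function.uncurry F)) :
    eLpNorm (fun x => ∫⁻ y, F x y ∂ν) p μ ≤ ∫⁻ y, eLpNorm (fun x => F x y) p μ ∂ν := by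
  have hp0 : p ≠ 0 := (one_pos.trans_le hp).ne'
  set N : β → ℝ≥0∞ := fun y => eLpNorm (fun x => F x y) p μ
  have hN : Measurable N := measurable_eLpNorm_left p hF
  rcases eq_or_ne (∫⁻ y, N y ∂ν) ⊤ with htop | htop
  · exact htop ▸ le_top
  have hFy (y : β) : Measurable fun x => F x y := hF.comp measurable_prodMk_right
  have hzero : ∀ᵐ x ∂μ, ∀ᵐ y ∂ν, N y = 0 → F x y = 0 := by
    have hS : MeasurableSet {z : α × β | N z.2 = 0 → F z.1 z.2 = 0} :=
      ((hN.comp measurable_snd) (measurableSet_singleton 0)).imp (hF (measurableSet_singleton 0))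
    refine (Measure.ae_ae_comm hS).2 (.of_forall fun y => ?_)
    rcases eq_or_ne (N y) 0 with hy | hy
    · filter_upwards [(eLpNorm_eq_zero_iff (hFy y).aestronglyMeasurable hp0).1 hy] with x hx _
      exact hx
    · simp [hy]
  -- Normalise the sections of `F` and move their norms into the measure.
  have hdensity : ∀ᵐ x ∂μ, ∫⁻ y, F x y ∂ν = ∫⁻ y, (N y)⁻¹ * F x y ∂ν.withDensity N := by
    filter_upwards [hzero] with x hx
    have hFx : Measurable fun y => (N y)⁻¹ * F x y := hN.inv.mul (hF.comp measurable_prodMk_left)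
    rw [lintegral_withDensity_eq_lintegral_mul _ hN hFx]
    refine lintegral_congr_ae ?_
    filter_upwards [hx, ae_lt_top hN htop] with y hy hlt
    rcases eq_or_ne (N y) 0 with h0 | h0
    · simp [hy h0]
    · rw [Pi.mul_apply, ← mul_assoc, ENNReal.mul_inv_cancel h0 hlt.ne, one_mul]
  rw [eLpNorm_congr_ae hdensity, ← setLIntegral_univ N, ← withDensity_apply N .univ]
  refine eLpNorm_lintegral_le_measure_univ hp
    (((hN.comp measurable_snd).inv).mul hF) (.of_forall fun y => ?_)
  rw [eLpNorm_const_mul_ennreal hp0 _ (hFy y)]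
  exact ENNReal.inv_mul_le_one _

end Minkowski

section Young

variable {G : Type*} [AddCommGroup G] [MeasurableSpace G] [MeasurableAdd₂ G]
  {μ : Measure G} [μ.IsAddLeftInvariant]

theorem eLpNorm_add_right {f : G → ℝ≥0∞} (hf : Measurable f) (p : ℝ≥0∞) (a : G) :
    eLpNorm (fun x => f (x + a)) p μ = eLpNorm f p μ :=
  eLpNorm_comp_measurePreserving hf.aestronglyMeasurable (measurePreserving_add_right μ a)

theorem eLpNorm_eLpNorm_le_of_le_lintegral [SFinite μ] {p q : ℝ≥0∞} (hp : 1 ≤ p) (hq : 1 ≤ q)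
    {K : G × G → ℝ≥0∞} (hK : Measurable K) {F H : G → G → ℝ≥0∞}
    (hF : Measurable (Function.uncurry F))
    (hH : ∀ x ξ, H x ξ ≤ ∫⁻ z, K z * F (x + z.1) (ξ + z.2) ∂μ.prod μ) :
    eLpNorm (fun ξ => eLpNorm (fun x => H x ξ) p μ) q μ ≤
      (∫⁻ z, K z ∂μ.prod μ) * eLpNorm (fun ξ => eLpNorm (fun x => F x ξ) p μ) q μ := by
  set N : G → ℝ≥0∞ := fun ξ => eLpNorm (fun x => F x ξ) p μ
  have hN : Measurable N := measurable_eLpNorm_left p hF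
  have hFξ (ξ : G) : Measurable fun x => F x ξ := hF.comp measurable_prodMk_right
  have inner (ξ : G) : eLpNorm (fun x => H x ξ) p μ ≤ ∫⁻ z, K z * N (ξ + z.2) ∂μ.prod μ := by
    have hKF : Measurable (Function.uncurry fun x (z : G × G) => K z * F (x + z.1) (ξ + z.2)) :=
      (hK.comp measurable_snd).mul <| hF.comp <|
        show Measurable fun w : G × G × G => (w.1 + w.2.1, ξ + w.2.2) by fun_prop
    refine (eLpNorm_mono_enorm (hH · ξ)).trans ((eLpNorm_lintegral_le hp hKF).trans_eq ?_)
    refine lintegral_congr fun z => ?_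
    have hFz : Measurable fun x => F (x + z.1) (ξ + z.2) :=
      (hFξ _).comp (measurable_add_const z.1)
    rw [eLpNorm_const_mul_ennreal (one_pos.trans_le hp).ne' _ hFz, eLpNorm_add_right (hFξ _)]
  have hKN : Measurable (Function.uncurry fun ξ (z : G × G) => K z * N (ξ + z.2)) :=
    (hK.comp measurable_snd).mul <| hN.comp <|
      show Measurable fun w : G × G × G => w.1 + w.2.2 by fun_prop
  refine (eLpNorm_mono_enorm inner).trans ((eLpNorm_lintegral_le hq hKN).trans_eq ?_)
  rw [← lintegral_mul_const _ hK]
  refine lintegral_congr fun z => ?_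
  have hNz : Measurable fun ξ => N (ξ + z.2) := hN.comp (measurable_add_const z.2)
  rw [eLpNorm_const_mul_ennreal (one_pos.trans_le hq).ne' _ hNz, eLpNorm_add_right hN]

end Young

section Slices

theorem norm_iteratedFDeriv_comp_clm_le {E F G : Type*} [NormedAddCommGroup E] [NormedSpace ℝ E]
    [NormedAddCommGroup F] [NormedSpace ℝ F] [NormedAddCommGroup G] [NormedSpace ℝ G]
    {L : E →L[ℝ] F} (hL : ‖L‖ ≤ 1) {n : ℕ} {f : F → G} (hf : ContDiff ℝ n f) (x : E) :
    ‖iteratedFDeriv ℝ n (f ∘ L) x‖ ≤ ‖iteratedFDeriv ℝ n f (L x)‖ := by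
  rw [L.iteratedFDeriv_comp_right hf x le_rfl]
  refine (ContinuousMultilinearMap.norm_compContinuousLinearMap_le _ _).trans ?_
  refine mul_le_of_le_one_right (norm_nonneg _) ?_
  simpa using pow_le_one₀ (norm_nonneg L) hL

variable {V W : Type} [NormedAddCommGroup V] [NormedSpace ℝ V]
  [NormedAddCommGroup W] [NormedSpace ℝ W]

/-- The section `Φ(·, w)` of a Schwartz function on a product. -/
def prodSlice (w : W) : 𝓢(V × W, ℂ) →L[ℂ] 𝓢(V, ℂ) :=
  SchwartzMap.compCLMOfAntilipschitz ℂ (K := 1) (g := fun t => (t, w))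
    (by
      have : (fun t : V => (t, w)) = fun t => ContinuousLinearMap.inl ℝ V W t + (0, w) := by
        ext t <;> simp
      rw [this]
      fun_prop)
    (AntilipschitzWith.of_le_mul_dist fun t t' => by simp [Prod.dist_eq])

@[simp]
theorem prodSlice_apply (w : W) (Φ : 𝓢(V × W, ℂ)) (t : V) : prodSlice w Φ t = Φ (t, w) := rfl

theorem norm_iteratedFDeriv_prodSlice_le (w : W) (Φ : 𝓢(V × W, ℂ)) (n : ℕ) (t : V) :
    ‖iteratedFDeriv ℝ n (prodSlice w Φ) t‖ ≤ ‖iteratedFDeriv ℝ n Φ (t, w)‖ := by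
  have hΦ : ContDiff ℝ n fun z => Φ (z + (0, w)) := (Φ.smooth n).comp (by fun_prop)
  have h := norm_iteratedFDeriv_comp_clm_le (ContinuousLinearMap.norm_inl_le_one ℝ V W) hΦ t
  rw [iteratedFDeriv_comp_add_right] at h
  simpa [Function.comp_def, ← prodSlice_apply] using h

theorem norm_iteratedFDeriv_prodSlice_sub_le (w w' : W) (Φ : 𝓢(V × W, ℂ)) (n : ℕ) (t : V) :
    ‖iteratedFDeriv ℝ n (prodSlice w Φ - prodSlice w' Φ) t‖ ≤
      ‖iteratedFDeriv ℝ n Φ (t, w) - iteratedFDeriv ℝ n Φ (t, w')‖ := by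
  have hΦ (w : W) : ContDiff ℝ n fun z => Φ (z + (0, w)) := (Φ.smooth n).comp (by fun_prop)
  have h := norm_iteratedFDeriv_comp_clm_le (ContinuousLinearMap.norm_inl_le_one ℝ V W)
    ((hΦ w).sub (hΦ w')) t
  have e : (fun z => Φ (z + (0, w)) - Φ (z + (0, w'))) =
    (fun z => Φ (z + (0, w))) - fun z => Φ (z + (0, w')) := rfl
  rw [e, iteratedFDeriv_sub_apply (hΦ w).contDiffAt (hΦ w').contDiffAt,
    iteratedFDeriv_comp_add_right, iteratedFDeriv_comp_add_right] at h
  have e' : ⇑(prodSlice w Φ - prodSlice w' Φ) =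
    ((fun z => Φ (z + (0, w))) - fun z => Φ (z + (0, w'))) ∘ ContinuousLinearMap.inl ℝ V W := by
    ext; simp
  rw [e']
  simpa using h

theorem one_add_norm_pow_mul_seminorm_prodSlice_le (k n N : ℕ) (Φ : 𝓢(V × W, ℂ)) (w : W) :
    (1 + ‖w‖) ^ N * SchwartzMap.seminorm ℂ k n (prodSlice w Φ) ≤
      2 ^ (k + N) * (Finset.Iic (k + N, n)).sup (schwartzSeminormFamily ℂ (V × W) ℂ) Φ := by
  have hw : 0 < (1 + ‖w‖) ^ N := by positivity
  rw [mul_comm, ← le_div_iff₀ hw]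
  refine SchwartzMap.seminorm_le_bound ℂ k n _ (by positivity) fun t => ?_
  rw [le_div_iff₀ hw]
  have h2 : ‖t‖ ≤ 1 + ‖(t, w)‖ := (norm_fst_le (t, w)).trans (by linarith)
  have h3 : 1 + ‖w‖ ≤ 1 + ‖(t, w)‖ := by simp
  calc ‖t‖ ^ k * ‖iteratedFDeriv ℝ n (prodSlice w Φ) t‖ * (1 + ‖w‖) ^ N
      ≤ (1 + ‖(t, w)‖) ^ k * ‖iteratedFDeriv ℝ n Φ (t, w)‖ * (1 + ‖(t, w)‖) ^ N := by
        gcongr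
        exact norm_iteratedFDeriv_prodSlice_le w Φ n t
    _ = (1 + ‖(t, w)‖) ^ (k + N) * ‖iteratedFDeriv ℝ n Φ (t, w)‖ := by rw [pow_add]; ring
    _ ≤ _ := SchwartzMap.one_add_le_sup_seminorm_apply (𝕜 := ℂ) (m := (k + N, n))
      le_rfl le_rfl Φ (t, w)

theorem seminorm_prodSlice_sub_le (k n : ℕ) (Φ : 𝓢(V × W, ℂ)) (w w' : W) :
    SchwartzMap.seminorm ℂ k n (prodSlice w Φ - prodSlice w' Φ) ≤
      SchwartzMap.seminorm ℂ k (n + 1) Φ * ‖w - w'‖ := by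
  refine SchwartzMap.seminorm_le_bound ℂ k n _ (by positivity) fun t => ?_
  have hd : Differentiable ℝ (iteratedFDeriv ℝ n Φ) :=
    (Φ.smooth ⊤).differentiable_iteratedFDeriv (by exact_mod_cast ENat.natCast_lt_top n)
  have hsegment : ∀ z ∈ segment ℝ (t, w') (t, w),
      ‖(‖t‖ ^ k) • fderiv ℝ (iteratedFDeriv ℝ n Φ) z‖ ≤ SchwartzMap.seminorm ℂ k (n + 1) Φ := by
    rintro z ⟨a, b, -, -, hab, rfl⟩
    have ht : ‖t‖ ≤ ‖a • (t, w') + b • (t, w)‖ := by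
      simp [← add_smul, hab]
    refine (ContinuousLinearMap.opNorm_smul_le _ _).trans ?_
    rw [norm_pow, norm_norm, norm_fderiv_iteratedFDeriv]
    refine le_trans ?_ (SchwartzMap.le_seminorm ℂ k (n + 1) Φ (a • (t, w') + b • (t, w)))
    gcongr
  have mean_value := (convex_segment (t, w') (t, w)).norm_image_sub_le_of_norm_hasFDerivWithin_le
    (fun z _ => ((hd z).hasFDerivAt.const_smul (‖t‖ ^ k)).hasFDerivWithinAt) hsegment
    (left_mem_segment ℝ _ _) (right_mem_segment ℝ _ _)
  rw [Pi.smul_apply, Pi.smul_apply, ← smul_sub, norm_smul, norm_pow, norm_norm, Prod.mk_sub_mk,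
    sub_self, Prod.norm_mk, norm_zero, max_eq_right (norm_nonneg _)] at mean_value
  refine le_trans ?_ mean_value
  gcongr
  exact norm_iteratedFDeriv_prodSlice_sub_le w w' Φ n t

theorem continuous_prodSlice (Φ : 𝓢(V × W, ℂ)) : Continuous fun w => prodSlice w Φ := by
  refine continuous_iff_continuousAt.2 fun w =>
    ((schwartz_withSeminorms ℂ V ℂ).tendsto_nhds _ _).2 fun ⟨k, n⟩ ε hε => ?_
  have h : Filter.Tendsto (fun w' => SchwartzMap.seminorm ℂ k (n + 1) Φ * ‖w' - w‖) (nhds w)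
      (nhds 0) := by
    have : Continuous fun w' => SchwartzMap.seminorm ℂ k (n + 1) Φ * ‖w' - w‖ := by fun_prop
    simpa using this.tendsto w
  filter_upwards [h.eventually_lt_const hε] with w' hw'
  exact (seminorm_prodSlice_sub_le k n Φ w' w).trans_lt hw'

theorem lineDerivOp_prodSlice (w : W) (Φ : 𝓢(V × W, ℂ)) (m : V) :
    ∂_{m} (prodSlice w Φ) = prodSlice w (∂_{((m, 0) : V × W)} Φ) := by
  ext t
  have h : HasFDerivAt (prodSlice w Φ)
      ((fderiv ℝ Φ (t, w)).comp (ContinuousLinearMap.inl ℝ V W)) t :=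
    HasFDerivAt.comp (g := Φ) (f := fun t => (t, w)) t (Φ.hasFDerivAt _)
      (hasFDerivAt_prodMk_left t w)
  rw [prodSlice_apply, SchwartzMap.lineDerivOp_apply_eq_fderiv,
    SchwartzMap.lineDerivOp_apply_eq_fderiv, h.fderiv]
  simp

end Slices

section Fubini

variable {V W : Type} [NormedAddCommGroup V] [NormedSpace ℝ V]

theorem exists_norm_clm_le_sup_seminorm {E : Type*} [NormedAddCommGroup E] [NormedSpace ℂ E]
    (T : 𝓢(V, ℂ) →L[ℂ] E) : ∃ (s : Finset (ℕ × ℕ)) (C : ℝ), 0 ≤ C ∧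
      ∀ φ, ‖T φ‖ ≤ C * s.sup (schwartzSeminormFamily ℂ V ℂ) φ := by
  obtain ⟨s, C, -, h⟩ := Seminorm.bound_of_continuous (schwartz_withSeminorms ℂ V ℂ)
    ((normSeminorm ℂ E).comp (T : 𝓢(V, ℂ) →ₗ[ℂ] E)) (continuous_norm.comp T.continuous)
  exact ⟨s, C, C.2, h⟩

/-- The Banach space of bounded continuous functions on `V` with values in `n`-linear forms. The
metric on forms is given explicitly, since the one found by instance search does not unify with the
one induced by the norm. -/
def BoundedMultilinear (V : Type) [NormedAddCommGroup V] [NormedSpace ℝ V] (n : ℕ) : Type :=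
  @BoundedContinuousFunction V (V [×n]→L[ℝ] ℂ) _ SeminormedAddCommGroup.toPseudoMetricSpace

instance (n : ℕ) : NormedAddCommGroup (BoundedMultilinear V n) :=
  BoundedContinuousFunction.instNormedAddCommGroup

instance (n : ℕ) : NormedSpace ℂ (BoundedMultilinear V n) :=
  BoundedContinuousFunction.instNormedSpace

instance (n : ℕ) : CompleteSpace (BoundedMultilinear V n) :=
  BoundedContinuousFunction.instCompleteSpace

instance (n : ℕ) : FunLike (BoundedMultilinear V n) V (V [×n]→L[ℝ] ℂ) :=
  BoundedContinuousFunction.instFunLike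


/-- The map `φ ↦ ‖·‖ ^ k D^n φ` into a Banach space, whose norm is the Schwartz seminorm of
index `(k, n)`. -/
def weightedDeriv (V : Type) [NormedAddCommGroup V] [NormedSpace ℝ V] (k n : ℕ) :
    𝓢(V, ℂ) →L[ℂ] BoundedMultilinear V n :=
  SchwartzMap.mkCLMtoNormedSpace (𝕜 := ℂ) (𝕜' := ℂ) (σ := RingHom.id ℂ)
    (fun φ : 𝓢(V, ℂ) => BoundedContinuousFunction.ofNormedAddCommGroup
      (fun t => (‖t‖ ^ k) • iteratedFDeriv ℝ n φ t)
      ((continuous_norm.pow k).smul ((φ.smooth n).continuous_iteratedFDeriv le_rfl))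
      (SchwartzMap.seminorm ℂ k n φ)
      (fun t => by
        rw [norm_smul, norm_pow, norm_norm]; exact SchwartzMap.le_seminorm ℂ k n φ t))
    (fun φ ψ : 𝓢(V, ℂ) => by
      refine DFunLike.ext _ _ fun t => ?_
      change (‖t‖ ^ k) • iteratedFDeriv ℝ n (φ + ψ : V → ℂ) t =
        (‖t‖ ^ k) • iteratedFDeriv ℝ n φ t + (‖t‖ ^ k) • iteratedFDeriv ℝ n ψ t
      rw [iteratedFDeriv_add_apply (φ.smooth n).contDiffAt (ψ.smooth n).contDiffAt, smul_add])
    (fun (c : ℂ) (φ : 𝓢(V, ℂ)) => by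
      refine DFunLike.ext _ _ fun t => ?_
      change (‖t‖ ^ k) • iteratedFDeriv ℝ n (c • φ : V → ℂ) t =
        c • (‖t‖ ^ k) • iteratedFDeriv ℝ n φ t
      rw [iteratedFDeriv_const_smul_apply (φ.smooth n).contDiffAt, smul_comm])
    ⟨{(k, n)}, 1, zero_le_one, fun φ => by
      rw [one_mul, Finset.sup_singleton]
      exact BoundedContinuousFunction.norm_ofNormedAddCommGroup_le _ (apply_nonneg _ _) _⟩

theorem weightedDeriv_apply (k n : ℕ) (φ : 𝓢(V, ℂ)) (t : V) :
    weightedDeriv V k n φ t = (‖t‖ ^ k) • iteratedFDeriv ℝ n φ t := rfl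

theorem seminorm_le_norm_weightedDeriv (k n : ℕ) (φ : 𝓢(V, ℂ)) :
    SchwartzMap.seminorm ℂ k n φ ≤ ‖weightedDeriv V k n φ‖ := by
  refine SchwartzMap.seminorm_le_bound ℂ k n φ (norm_nonneg _) fun t => ?_
  have h : ‖weightedDeriv V k n φ t‖ ≤ ‖weightedDeriv V k n φ‖ :=
    BoundedContinuousFunction.norm_coe_le_norm _ t
  rwa [weightedDeriv_apply, norm_smul, norm_pow, norm_norm] at h

theorem exists_clm_comp_eq_of_norm_le {X E : Type*} [AddCommGroup X] [Module ℂ X]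
    [NormedAddCommGroup E] [NormedSpace ℂ E] (u : X →ₗ[ℂ] ℂ) (j : X →ₗ[ℂ] E) (C : ℝ)
    (h : ∀ x, ‖u x‖ ≤ C * ‖j x‖) : ∃ F : E →L[ℂ] ℂ, ∀ x, u x = F (j x) := by
  have hker : u ∈ (LinearMap.ker j).dualAnnihilator := by
    rw [Submodule.mem_dualAnnihilator]
    intro x hx
    simpa [LinearMap.mem_ker.1 hx] using h x
  rw [← LinearMap.range_dualMap_eq_dualAnnihilator_ker] at hker
  obtain ⟨f, rfl⟩ := hker
  let f₀ : LinearMap.range j →L[ℂ] ℂ := (f.comp (LinearMap.range j).subtype).mkContinuous C (by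
    rintro ⟨_, x, rfl⟩
    exact h x)
  obtain ⟨F, hF, -⟩ := exists_extension_norm_eq (𝕜 := ℂ) (LinearMap.range j) f₀
  exact ⟨F, fun x => (hF ⟨j x, x, rfl⟩).symm⟩

theorem exists_eq_clm_weightedDeriv (u : 𝓢'(V, ℂ)) :
    ∃ (s : Finset (ℕ × ℕ)) (F : (Π i : s, BoundedMultilinear V i.1.2) →L[ℂ] ℂ),
      ∀ φ, u φ = F fun i => weightedDeriv V i.1.1 i.1.2 φ := by
  obtain ⟨s, C, hC, hu⟩ := exists_norm_le_sup_seminorm (V := V) u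
  let j : 𝓢(V, ℂ) →ₗ[ℂ] Π i : s, BoundedMultilinear V i.1.2 :=
    LinearMap.pi fun i => (weightedDeriv V i.1.1 i.1.2 : 𝓢(V, ℂ) →ₗ[ℂ] BoundedMultilinear V i.1.2)
  refine ⟨s, exists_clm_comp_eq_of_norm_le
    (E := Π i : s, BoundedMultilinear V i.1.2) ((u : 𝓢(V, ℂ) →L[ℂ] ℂ) : 𝓢(V, ℂ) →ₗ[ℂ] ℂ) j C
    fun φ => (hu φ).trans ?_⟩
  gcongr
  exact Seminorm.finset_sup_apply_le (norm_nonneg _) fun i hi =>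
    (seminorm_le_norm_weightedDeriv i.1 i.2 φ).trans (norm_le_pi_norm (j φ) ⟨i, hi⟩)

variable [NormedAddCommGroup W] [InnerProductSpace ℝ W] [FiniteDimensional ℝ W]
  [MeasurableSpace W] [BorelSpace W]

theorem exists_integrable_seminorm_prodSlice_le (s : Finset (ℕ × ℕ)) (Φ : 𝓢(V × W, ℂ)) :
    ∃ b : W → ℝ, Integrable b ∧
      ∀ w, s.sup (schwartzSeminormFamily ℂ V ℂ) (prodSlice w Φ) ≤ b w := by
  let N := (volume : Measure W).integrablePower
  let C (i : ℕ × ℕ) : ℝ := 2 ^ (i.1 + N) *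
    (Finset.Iic (i.1 + N, i.2)).sup (schwartzSeminormFamily ℂ (V × W) ℂ) Φ
  refine ⟨fun w => ∑ i ∈ s, C i * (1 + ‖w‖) ^ (-(N : ℝ)), integrable_finsetSum _ fun i _ =>
    (Measure.integrable_pow_neg_integrablePower (volume : Measure W)).const_mul (C i), fun w => ?_⟩
  refine Seminorm.finset_sup_apply_le (Finset.sum_nonneg fun i _ => by positivity) fun i hi =>
    le_trans ?_ (Finset.single_le_sum (fun i _ => by positivity) hi)
  have hw : 0 < (1 + ‖w‖) ^ N := by positivity
  rw [Real.rpow_neg (by positivity), Real.rpow_natCast, ← div_eq_mul_inv, le_div_iff₀ hw, mul_comm]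
  exact one_add_norm_pow_mul_seminorm_prodSlice_le i.1 i.2 N Φ w

theorem integrable_clm_prodSlice {E : Type*} [NormedAddCommGroup E] [NormedSpace ℂ E]
    (T : 𝓢(V, ℂ) →L[ℂ] E) (Φ : 𝓢(V × W, ℂ)) : Integrable fun w => T (prodSlice w Φ) := by
  obtain ⟨s, C, hC, hT⟩ := exists_norm_clm_le_sup_seminorm T
  obtain ⟨b, hb, hle⟩ := exists_integrable_seminorm_prodSlice_le s Φ
  refine (hb.const_mul C).mono' (T.continuous.comp (continuous_prodSlice Φ)).aestronglyMeasurable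
    (.of_forall fun w => (hT _).trans ?_)
  exact mul_le_mul_of_nonneg_left (hle w) hC

theorem integrable_prodSlice (Φ : 𝓢(V × W, ℂ)) (t : V) : Integrable fun w => Φ (t, w) :=
  integrable_clm_prodSlice (TemperedDistribution.delta t) Φ

theorem lineDerivOp_eq_integral {Φ : 𝓢(V × W, ℂ)} {φ : 𝓢(V, ℂ)}
    (h : ∀ t, φ t = ∫ w, Φ (t, w)) (m t : V) :
    (∂_{m} φ) t = ∫ w, (∂_{((m, 0) : V × W)} Φ) (t, w) := by
  let Φ' := ∂_{((m, 0) : V × W)} Φ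
  let sup_norm := toBoundedContinuousFunctionCLM ℂ V ℂ
  have hderiv (w : W) (r : ℝ) :
      HasDerivAt (fun r : ℝ => Φ (t + r • m, w)) (Φ' (t + r • m, w)) r := by
    rw [SchwartzMap.lineDerivOp_apply_eq_fderiv]
    have hline : HasDerivAt (fun r : ℝ => ((t + r • m, w) : V × W)) (m, 0) r := by
      simpa using (((hasDerivAt_id r).smul_const m).const_add t).prodMk (hasDerivAt_const r w)
    exact (Φ.hasFDerivAt (t + r • m, w)).comp_hasDerivAt r hline
  have hasDeriv := (hasDerivAt_integral_of_dominated_loc_of_deriv_le (μ := (volume : Measure W))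
    (F := fun (r : ℝ) w => Φ (t + r • m, w)) (F' := fun (r : ℝ) w => Φ' (t + r • m, w))
    (x₀ := 0) (s := Set.univ) (bound := fun w => ‖sup_norm (prodSlice w Φ')‖) Filter.univ_mem
    (.of_forall fun r => (integrable_prodSlice Φ _).aestronglyMeasurable)
    (integrable_prodSlice Φ _) (integrable_prodSlice Φ' _).aestronglyMeasurable
    (.of_forall fun w r _ => (sup_norm (prodSlice w Φ')).norm_coe_le_norm (t + r • m))
    (integrable_clm_prodSlice sup_norm Φ').norm (.of_forall fun w r _ => hderiv w r)).2.deriv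
  simp only [zero_smul, add_zero] at hasDeriv
  rw [← hasDeriv, SchwartzMap.lineDerivOp_apply, lineDeriv]
  simp only [h]

theorem iteratedFDeriv_eq_integral {n : ℕ} (m : Fin n → V) {Φ : 𝓢(V × W, ℂ)} {φ : 𝓢(V, ℂ)}
    (h : ∀ t, φ t = ∫ w, Φ (t, w)) (t : V) :
    iteratedFDeriv ℝ n φ t m = ∫ w, iteratedFDeriv ℝ n (prodSlice w Φ) t m := by
  simp only [← SchwartzMap.iteratedLineDerivOp_eq_iteratedFDeriv]
  induction n generalizing Φ φ with
  | zero => simpa using h t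
  | succ n ih =>
    simp only [LineDeriv.iteratedLineDerivOp_succ_right, lineDerivOp_prodSlice]
    exact ih _ (lineDerivOp_eq_integral h _)

theorem weightedDeriv_eq_integral (k n : ℕ) {Φ : 𝓢(V × W, ℂ)} {φ : 𝓢(V, ℂ)}
    (h : ∀ t, φ t = ∫ w, Φ (t, w)) :
    weightedDeriv V k n φ = ∫ w, weightedDeriv V k n (prodSlice w Φ) := by
  refine DFunLike.ext _ _ fun t => ContinuousMultilinearMap.ext fun m => ?_
  let L : BoundedMultilinear V n →L[ℝ] ℂ :=
    (ContinuousMultilinearMap.apply ℝ (fun _ => V) ℂ m).comp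
      (BoundedContinuousFunction.evalCLM ℝ t)
  refine Eq.trans ?_ (ContinuousLinearMap.integral_comp_comm (E := BoundedMultilinear V n) L
    (integrable_clm_prodSlice (weightedDeriv V k n) Φ))
  change (‖t‖ ^ k) • iteratedFDeriv ℝ n φ t m =
    ∫ w, (‖t‖ ^ k) • iteratedFDeriv ℝ n (prodSlice w Φ) t m
  rw [integral_smul, iteratedFDeriv_eq_integral m h t]

theorem apply_eq_integral (u : 𝓢'(V, ℂ)) {Φ : 𝓢(V × W, ℂ)} {φ : 𝓢(V, ℂ)}
    (h : ∀ t, φ t = ∫ w, Φ (t, w)) : u φ = ∫ w, u (prodSlice w Φ) := by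
  obtain ⟨s, F, hF⟩ := exists_eq_clm_weightedDeriv u
  have hint (i : s) : Integrable fun w => weightedDeriv V i.1.1 i.1.2 (prodSlice w Φ) :=
    integrable_clm_prodSlice (weightedDeriv V i.1.1 i.1.2) Φ
  simp only [hF]
  rw [F.integral_comp_comm (Integrable.of_eval hint)]
  congr 1
  ext1 i
  rw [eval_integral hint, weightedDeriv_eq_integral _ _ h]

end Fubini

section Tensor

variable {V W : Type} [NormedAddCommGroup V] [NormedSpace ℝ V]
  [NormedAddCommGroup W] [NormedSpace ℝ W]

theorem norm_iteratedFDeriv_comp_fst_le (φ : 𝓢(V, ℂ)) (n : ℕ) (z : V × W) :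
    ‖iteratedFDeriv ℝ n (fun z : V × W => φ z.1) z‖ ≤ ‖iteratedFDeriv ℝ n φ z.1‖ :=
  norm_iteratedFDeriv_comp_clm_le (ContinuousLinearMap.norm_fst_le ℝ V W) (φ.smooth n) z

theorem norm_iteratedFDeriv_comp_snd_le (ψ : 𝓢(W, ℂ)) (n : ℕ) (z : V × W) :
    ‖iteratedFDeriv ℝ n (fun z : V × W => ψ z.2) z‖ ≤ ‖iteratedFDeriv ℝ n ψ z.2‖ :=
  norm_iteratedFDeriv_comp_clm_le (ContinuousLinearMap.norm_snd_le ℝ V W) (ψ.smooth n) z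

theorem norm_pow_mul_norm_iteratedFDeriv_mul_le (φ : 𝓢(V, ℂ)) (ψ : 𝓢(W, ℂ)) (k i j : ℕ)
    (z : V × W) :
    ‖z‖ ^ k * (‖iteratedFDeriv ℝ i φ z.1‖ * ‖iteratedFDeriv ℝ j ψ z.2‖) ≤
      SchwartzMap.seminorm ℂ k i φ * SchwartzMap.seminorm ℂ 0 j ψ +
        SchwartzMap.seminorm ℂ 0 i φ * SchwartzMap.seminorm ℂ k j ψ := by
  have hz : ‖z‖ ^ k ≤ ‖z.1‖ ^ k + ‖z.2‖ ^ k := by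
    rw [Prod.norm_def]
    rcases max_choice ‖z.1‖ ‖z.2‖ with h | h <;> rw [h] <;> simp
  have hφ : ‖iteratedFDeriv ℝ i φ z.1‖ ≤ SchwartzMap.seminorm ℂ 0 i φ := by
    simpa using SchwartzMap.le_seminorm ℂ 0 i φ z.1
  have hψ : ‖iteratedFDeriv ℝ j ψ z.2‖ ≤ SchwartzMap.seminorm ℂ 0 j ψ := by
    simpa using SchwartzMap.le_seminorm ℂ 0 j ψ z.2
  calc _ ≤ (‖z.1‖ ^ k + ‖z.2‖ ^ k) *
        (‖iteratedFDeriv ℝ i φ z.1‖ * ‖iteratedFDeriv ℝ j ψ z.2‖) := by gcongr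
    _ = ‖z.1‖ ^ k * ‖iteratedFDeriv ℝ i φ z.1‖ * ‖iteratedFDeriv ℝ j ψ z.2‖ +
        ‖iteratedFDeriv ℝ i φ z.1‖ * (‖z.2‖ ^ k * ‖iteratedFDeriv ℝ j ψ z.2‖) := by ring
    _ ≤ _ := by
      gcongr
      · exact SchwartzMap.le_seminorm ℂ k i φ z.1
      · exact SchwartzMap.le_seminorm ℂ k j ψ z.2

/-- The tensor product `(t, w) ↦ φ(t) ψ(w)` of Schwartz functions. -/
def tensorS (φ : 𝓢(V, ℂ)) (ψ : 𝓢(W, ℂ)) : 𝓢(V × W, ℂ) where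
  toFun z := φ z.1 * ψ z.2
  smooth' := ((φ.smooth ⊤).comp contDiff_fst).mul ((ψ.smooth ⊤).comp contDiff_snd)
  decay' k n := by
    refine ⟨∑ i ∈ Finset.range (n + 1), (n.choose i : ℝ) *
      (SchwartzMap.seminorm ℂ k i φ * SchwartzMap.seminorm ℂ 0 (n - i) ψ +
        SchwartzMap.seminorm ℂ 0 i φ * SchwartzMap.seminorm ℂ k (n - i) ψ), fun z => ?_⟩
    refine (mul_le_mul_of_nonneg_left (norm_iteratedFDeriv_mul_le
      ((φ.smooth n).comp contDiff_fst) ((ψ.smooth n).comp contDiff_snd) z le_rfl)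
      (by positivity)).trans ?_
    rw [Finset.mul_sum]
    refine Finset.sum_le_sum fun i _ => ?_
    rw [mul_assoc, mul_left_comm]
    gcongr
    refine le_trans ?_ (norm_pow_mul_norm_iteratedFDeriv_mul_le φ ψ k i (n - i) z)
    gcongr
    · exact norm_iteratedFDeriv_comp_fst_le φ i z
    · exact norm_iteratedFDeriv_comp_snd_le ψ (n - i) z

/-- The shear `(t, x) ↦ (t, t - x)`. -/
def shearEquiv (V : Type) [NormedAddCommGroup V] [NormedSpace ℝ V] : (V × V) ≃L[ℝ] (V × V) :=
  ContinuousLinearEquiv.equivOfInverse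
    ((ContinuousLinearMap.fst ℝ V V).prod
      (ContinuousLinearMap.fst ℝ V V - ContinuousLinearMap.snd ℝ V V))
    ((ContinuousLinearMap.fst ℝ V V).prod
      (ContinuousLinearMap.fst ℝ V V - ContinuousLinearMap.snd ℝ V V))
    (fun z => by ext <;> simp) (fun z => by ext <;> simp)

/-- The Schwartz function `(t, x) ↦ φ(t) ρ(t - x)`, whose sections in `t` are the products of `φ`
with the translates of `ρ`. -/
def mulTranslate (φ ρ : 𝓢(V, ℂ)) : 𝓢(V × V, ℂ) :=
  SchwartzMap.compCLMOfContinuousLinearEquiv ℂ (shearEquiv V) (tensorS φ ρ)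

@[simp]
theorem mulTranslate_apply (φ ρ : 𝓢(V, ℂ)) (t x : V) :
    mulTranslate φ ρ (t, x) = φ t * ρ (t - x) := rfl

/-- The pointwise product of two Schwartz functions. -/
def mulS (φ ψ : 𝓢(V, ℂ)) : 𝓢(V, ℂ) := SchwartzMap.smulLeftCLM ℂ φ ψ

@[simp]
theorem mulS_apply (φ ψ : 𝓢(V, ℂ)) (t : V) : mulS φ ψ t = φ t * ψ t :=
  SchwartzMap.smulLeftCLM_apply_apply φ.hasTemperateGrowth _ _

end Tensor

section TimeFreqShift

variable {V : Type} [NormedAddCommGroup V] [InnerProductSpace ℝ V]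

theorem conjS_conjS (g : 𝓢(V, ℂ)) : conjS (conjS g) = g := by
  ext t
  simp

theorem conjS_timeFreqShift (x ξ : V) (g : 𝓢(V, ℂ)) :
    conjS (timeFreqShift x ξ g) = timeFreqShift x (-ξ) (conjS g) := by
  ext t
  simp [← Complex.exp_conj, map_ofNat (starRingEnd ℂ) 2]

theorem stft_eq (g : 𝓢(V, ℂ)) (u : 𝓢'(V, ℂ)) (x ξ : V) :
    stft g u x ξ = u (timeFreqShift x (-ξ) (conjS g)) := by
  rw [stft, conjS_timeFreqShift]

theorem prodSlice_mulTranslate_timeFreqShift (x₀ ξ₀ x : V) (b γ : 𝓢(V, ℂ)) :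
    prodSlice x (mulTranslate (timeFreqShift x₀ ξ₀ b) γ) =
      timeFreqShift x₀ ξ₀ (prodSlice (x - x₀) (mulTranslate b γ)) := by
  ext t
  simp [mul_assoc]

variable [FiniteDimensional ℝ V]

theorem continuous_apply_compSubConst (u : 𝓢(V, ℂ) →L[ℂ] ℂ) (b : 𝓢(V, ℂ)) :
    Continuous fun x : V => u (b.compSubConstCLM ℂ x) := by
  refine continuous_iff_continuousAt.2 fun x => ?_
  obtain ⟨L, hL, -⟩ := hasFDerivAt_translate u (b.compSubConstCLM ℂ x)
  have at_zero : ContinuousAt (fun a : V => u ((b.compSubConstCLM ℂ x).compSubConstCLM ℂ (-a)))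
      (x - x) := by
    rw [sub_self]
    exact hL.continuousAt
  refine (at_zero.comp (f := fun y : V => x - y) (by fun_prop)).congr (.of_forall fun y => ?_)
  rw [Function.comp_apply]
  congr 1
  ext t
  simp

theorem continuous_stft_left (g : 𝓢(V, ℂ)) (u : 𝓢'(V, ℂ)) (ξ : V) :
    Continuous fun x => stft g u x ξ := by
  simp only [stft_eq]
  exact continuous_apply_compSubConst
    ((u : 𝓢(V, ℂ) →L[ℂ] ℂ).comp (SchwartzMap.smulLeftCLM ℂ (fun t : V =>
      Complex.exp (((2 * Real.pi * inner ℝ (-ξ) t : ℝ) : ℂ) * Complex.I)))) (conjS g)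

variable [MeasurableSpace V] [BorelSpace V]

theorem fourier_timeFreqShift (x ξ : V) (h : 𝓢(V, ℂ)) :
    𝓕 (timeFreqShift x ξ h) =
      Complex.exp (((2 * Real.pi * inner ℝ x ξ : ℝ) : ℂ) * Complex.I) •
        timeFreqShift ξ (-x) (𝓕 h) := by
  ext w
  rw [smul_apply, timeFreqShift_apply, smul_eq_mul, SchwartzMap.fourier_coe,
    SchwartzMap.fourier_coe, Real.fourier_eq', Real.fourier_eq', ← integral_const_mul,
    ← integral_const_mul]
  conv_rhs => rw [← integral_sub_right_eq_self _ x]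
  refine integral_congr_ae (.of_forall fun t => ?_)
  simp only [timeFreqShift_apply, smul_eq_mul, ← mul_assoc, ← Complex.exp_add]
  congr 2
  simp only [inner_sub_left, inner_sub_right, inner_neg_left, real_inner_comm t ξ]
  push_cast
  ring

theorem norm_fourier_timeFreqShift_apply (x ξ : V) (h : 𝓢(V, ℂ)) (w : V) :
    ‖𝓕 (timeFreqShift x ξ h) w‖ = ‖𝓕 h (w - ξ)‖ := by
  rw [fourier_timeFreqShift, smul_apply, timeFreqShift_apply, norm_smul, norm_mul,
    Complex.norm_exp_ofReal_mul_I, Complex.norm_exp_ofReal_mul_I, one_mul, one_mul]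

theorem continuous_stft_right (g : 𝓢(V, ℂ)) (u : 𝓢'(V, ℂ)) (x : V) :
    Continuous fun ξ => stft g u x ξ := by
  let b := timeFreqShift x 0 (conjS g)
  have h (ξ : V) : stft g u x ξ = u (𝓕⁻ ((𝓕 b).compSubConstCLM ℂ (-ξ))) := by
    have modulation : timeFreqShift x (-ξ) (conjS g) = timeFreqShift 0 (-ξ) b := by
      ext t
      simp [b]
    have translation : 𝓕 (timeFreqShift 0 (-ξ) b) = (𝓕 b).compSubConstCLM ℂ (-ξ) := by
      rw [fourier_timeFreqShift]
      ext t
      simp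
    rw [stft_eq, ← translation, FourierTransform.fourierInv_fourier_eq, modulation]
  simp only [h]
  exact (continuous_apply_compSubConst ((u : 𝓢(V, ℂ) →L[ℂ] ℂ).comp
    (FourierTransform.fourierInvCLM ℂ 𝓢(V, ℂ))) _).comp continuous_neg

theorem measurable_uncurry_enorm_stft (g : 𝓢(V, ℂ)) (u : 𝓢'(V, ℂ)) :
    Measurable (Function.uncurry fun x ξ => ‖stft g u x ξ‖ₑ) :=
  measurable_uncurry_of_continuous_of_measurable
    (fun ξ => (continuous_stft_left g u ξ).enorm)
    (fun x => (continuous_stft_right g u x).enorm.measurable)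

end TimeFreqShift

section Reconstruction

variable {V : Type} [NormedAddCommGroup V] [InnerProductSpace ℝ V]

/-- The Schwartz function `(t, ξ) ↦ e^{2πi ξ·t} h(t) a(ξ)`, whose sections in `t` are multiples of
the modulations of `h`. -/
def modTensor (h a : 𝓢(V, ℂ)) : 𝓢(V × V, ℂ) :=
  SchwartzMap.smulLeftCLM ℂ
    (fun z : V × V => Complex.exp (((2 * Real.pi * inner ℝ z.2 z.1 : ℝ) : ℂ) * Complex.I))
    (tensorS h a)

@[simp]
theorem modTensor_apply (h a : 𝓢(V, ℂ)) (t ξ : V) :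
    modTensor h a (t, ξ) =
      Complex.exp (((2 * Real.pi * inner ℝ ξ t : ℝ) : ℂ) * Complex.I) * (h t * a ξ) := by
  have phase : Function.HasTemperateGrowth fun z : V × V =>
      2 * Real.pi * (innerSL ℝ z.2 z.1 : ℝ) :=
    (Function.HasTemperateGrowth.const _).mul <|
      ContinuousLinearMap.bilinear_hasTemperateGrowth (𝕜 := ℝ) (innerSL ℝ)
        (ContinuousLinearMap.snd ℝ V V).hasTemperateGrowth
        (ContinuousLinearMap.fst ℝ V V).hasTemperateGrowth
  exact SchwartzMap.smulLeftCLM_apply_apply (hasTemperateGrowth_cexp_ofReal_mul_I.comp phase) _ _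

variable [FiniteDimensional ℝ V] [MeasurableSpace V] [BorelSpace V]

theorem apply_eq_integral_mulTranslate (u : 𝓢'(V, ℂ)) (φ : 𝓢(V, ℂ)) {ρ : 𝓢(V, ℂ)}
    (hρ : ∫ x, ρ x = 1) : u φ = ∫ x, u (prodSlice x (mulTranslate φ ρ)) := by
  refine apply_eq_integral u fun t => ?_
  simp only [mulTranslate_apply]
  rw [integral_const_mul, integral_sub_left_eq_self ρ, hρ, mul_one]

theorem apply_mulS_eq_integral (u : 𝓢'(V, ℂ)) (ψ h : 𝓢(V, ℂ)) :
    u (mulS ψ h) = ∫ ξ, 𝓕 ψ ξ * u (timeFreqShift 0 ξ h) := by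
  have fourier_inversion (t : V) : mulS ψ h t = ∫ ξ, modTensor h (𝓕 ψ) (t, ξ) := by
    have hψ : ψ t = 𝓕⁻ (𝓕 ψ) t := by rw [FourierTransform.fourierInv_fourier_eq]
    rw [mulS_apply, hψ, SchwartzMap.fourierInv_coe, Real.fourierInv_eq', ← integral_mul_const]
    congr! 2
    rw [modTensor_apply, smul_eq_mul]
    ring
  have section_eq (ξ : V) : prodSlice ξ (modTensor h (𝓕 ψ)) = 𝓕 ψ ξ • timeFreqShift 0 ξ h := by
    ext t
    simp
    ring
  simp only [apply_eq_integral u fourier_inversion, section_eq, map_smul, smul_eq_mul]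

theorem apply_eq_integral_timeFreqShift (u : 𝓢'(V, ℂ)) (φ : 𝓢(V, ℂ)) {γ b : 𝓢(V, ℂ)}
    (h : ∫ t, γ t * b t = 1) :
    u φ = ∫ x, ∫ ξ, 𝓕 (prodSlice x (mulTranslate φ γ)) ξ * u (timeFreqShift x ξ b) := by
  rw [apply_eq_integral_mulTranslate u φ (ρ := mulS γ b) (by simpa using h)]
  congr! 2 with x
  have factor : prodSlice x (mulTranslate φ (mulS γ b)) =
      mulS (prodSlice x (mulTranslate φ γ)) (b.compSubConstCLM ℂ x) := by
    ext t
    simp [mul_assoc]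
  have shift (ξ : V) : timeFreqShift 0 ξ (b.compSubConstCLM ℂ x) = timeFreqShift x ξ b := by
    ext t
    simp
  simp only [factor, apply_mulS_eq_integral, shift]

theorem integral_norm_sq_ne_zero {g : 𝓢(V, ℂ)} (hg : g ≠ 0) : ∫ t, ‖g t‖ ^ 2 ≠ 0 := by
  have hint : Integrable fun t => ‖g t‖ ^ 2 := by
    simpa [sq] using (mulS g (conjS g)).integrable (μ := volume).norm
  rw [Ne, integral_eq_zero_iff_of_nonneg (fun t => by positivity) hint]
  intro h
  have hzero := ((g.continuous.norm.pow 2).ae_eq_iff_eq volume continuous_zero).1 h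
  refine hg (SchwartzMap.ext fun t => ?_)
  simpa using congrFun hzero t

theorem exists_integral_mul_conjS_eq_one {g : 𝓢(V, ℂ)} (hg : g ≠ 0) :
    ∃ γ : 𝓢(V, ℂ), ∫ t, γ t * conjS g t = 1 := by
  have h : ∫ t, g t * conjS g t = ((∫ t, ‖g t‖ ^ 2 : ℝ) : ℂ) := by
    rw [← integral_complex_ofReal]
    simp [Complex.mul_conj, Complex.normSq_eq_norm_sq]
  refine ⟨((∫ t, ‖g t‖ ^ 2 : ℝ) : ℂ)⁻¹ • g, ?_⟩
  simp only [smul_apply, smul_eq_mul, mul_assoc]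
  rw [integral_const_mul, h, inv_mul_cancel₀ (by exact_mod_cast integral_norm_sq_ne_zero hg)]

theorem continuous_fourier_prodSlice {W : Type} [NormedAddCommGroup W] [NormedSpace ℝ W]
    (Φ : 𝓢(V × W, ℂ)) :
    Continuous fun z : W × V => 𝓕 (prodSlice z.1 Φ) z.2 := by
  have h : Continuous fun w => toBoundedContinuousFunctionCLM ℂ V ℂ
      (FourierTransform.fourierCLM ℂ 𝓢(V, ℂ) (prodSlice w Φ)) :=
    (ContinuousLinearMap.continuous _).comp
      ((ContinuousLinearMap.continuous _).comp (continuous_prodSlice Φ))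
  exact (h.comp continuous_fst).eval continuous_snd

theorem lintegral_enorm_fourier_prodSlice_lt_top {W : Type} [NormedAddCommGroup W]
    [InnerProductSpace ℝ W] [FiniteDimensional ℝ W] [MeasurableSpace W] [BorelSpace W]
    (Φ : 𝓢(V × W, ℂ)) : ∫⁻ w, ∫⁻ ξ, ‖𝓕 (prodSlice w Φ) ξ‖ₑ < ⊤ := by
  have h := (integrable_clm_prodSlice
    ((toLpCLM ℂ ℂ 1 volume).comp (FourierTransform.fourierCLM ℂ 𝓢(V, ℂ))) Φ).hasFiniteIntegral
  refine lt_of_eq_of_lt (lintegral_congr fun w => ?_) h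
  change _ = ‖(𝓕 (prodSlice w Φ)).toLp 1 volume‖ₑ
  rw [← ofReal_norm, SchwartzMap.norm_toLp,
    ENNReal.ofReal_toReal ((𝓕 (prodSlice w Φ)).memLp 1 volume).eLpNorm_ne_top,
    eLpNorm_one_eq_lintegral_enorm]

end Reconstruction

section WindowIndependence

variable {V : Type} [NormedAddCommGroup V] [InnerProductSpace ℝ V] [FiniteDimensional ℝ V]
  [MeasurableSpace V] [BorelSpace V]

theorem enorm_stft_le_lintegral_lintegral {g γ : 𝓢(V, ℂ)} (hγ : ∫ t, γ t * conjS g t = 1)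
    (g₁ : 𝓢(V, ℂ)) (u : 𝓢'(V, ℂ)) (x ξ : V) :
    ‖stft g₁ u x ξ‖ₑ ≤ ∫⁻ y, ∫⁻ η, ‖𝓕 (prodSlice y (mulTranslate (conjS g₁) γ)) (-η)‖ₑ *
      ‖stft g u (x + y) (ξ + η)‖ₑ := by
  rw [stft_eq, apply_eq_integral_timeFreqShift u _ hγ]
  refine (enorm_integral_le_lintegral_enorm _).trans ?_
  rw [← lintegral_add_left_eq_self _ x]
  gcongr with y
  refine (enorm_integral_le_lintegral_enorm _).trans (le_of_eq ?_)
  rw [← lintegral_sub_left_eq_self _ (-ξ)]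
  refine lintegral_congr fun η => ?_
  rw [enorm_mul, stft_eq, prodSlice_mulTranslate_timeFreqShift, ← ofReal_norm,
    norm_fourier_timeFreqShift_apply, ofReal_norm, add_sub_cancel_left, neg_add',
    sub_sub_cancel_left]

theorem exists_enorm_stft_le_lintegral {g : 𝓢(V, ℂ)} (hg : g ≠ 0) (g₁ : 𝓢(V, ℂ)) :
    ∃ K : V × V → ℝ≥0∞, Measurable K ∧ ∫⁻ z, K z ∂volume.prod volume < ⊤ ∧
      ∀ (u : 𝓢'(V, ℂ)) x ξ, ‖stft g₁ u x ξ‖ₑ ≤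
        ∫⁻ z, K z * ‖stft g u (x + z.1) (ξ + z.2)‖ₑ ∂volume.prod volume := by
  obtain ⟨γ, hγ⟩ := exists_integral_mul_conjS_eq_one hg
  let Φ := mulTranslate (conjS g₁) γ
  have hK : Measurable fun z : V × V => ‖𝓕 (prodSlice z.1 Φ) (-z.2)‖ₑ :=
    ((continuous_fourier_prodSlice Φ).comp (by fun_prop : Continuous fun z : V × V =>
      (z.1, -z.2))).enorm.measurable
  refine ⟨_, hK, ?_, fun u x ξ => ?_⟩
  · rw [lintegral_prod _ hK.aemeasurable]
    have reflect (y : V) := lintegral_neg_eq_self (μ := volume) fun η => ‖𝓕 (prodSlice y Φ) η‖ₑ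
    simpa only [reflect] using lintegral_enorm_fourier_prodSlice_lt_top Φ
  · have hstft : Measurable fun z : V × V => ‖stft g u (x + z.1) (ξ + z.2)‖ₑ :=
      (measurable_uncurry_enorm_stft g u).comp (f := fun z : V × V => (x + z.1, ξ + z.2))
        (by fun_prop)
    exact (enorm_stft_le_lintegral_lintegral hγ g₁ u x ξ).trans_eq
      (lintegral_prod _ (hK.mul hstft).aemeasurable).symm

theorem modulationSpace_subset {g : 𝓢(V, ℂ)} (hg : g ≠ 0) (g₁ : 𝓢(V, ℂ)) {p q : ℝ≥0∞} (hp : 1 ≤ p)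
    (hq : 1 ≤ q) : modulationSpace g p q ⊆ modulationSpace g₁ p q := by
  intro u hu
  obtain ⟨K, hK, hKfin, hle⟩ := exists_enorm_stft_le_lintegral hg g₁
  have norm_le := eLpNorm_eLpNorm_le_of_le_lintegral hp hq hK
    (measurable_uncurry_enorm_stft g u) (hle u)
  simp only [eLpNorm_enorm] at norm_le
  exact norm_le.trans_lt (ENNReal.mul_lt_top hKfin hu)

theorem modulationSpace_eq {g g₁ : 𝓢(V, ℂ)} (hg : g ≠ 0) (hg₁ : g₁ ≠ 0) {p q : ℝ≥0∞}
    (hp : 1 ≤ p) (hq : 1 ≤ q) : modulationSpace g p q = modulationSpace g₁ p q :=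
  (modulationSpace_subset hg g₁ hp hq).antisymm (modulationSpace_subset hg₁ g hp hq)

end WindowIndependence

section FourierMultiplier

open TemperedDistribution

variable {V : Type} [NormedAddCommGroup V] [InnerProductSpace ℝ V]

/-- A unimodular character of second degree `c` of temperate growth: it is multiplicative up to the
bicharacter `e^{2πi ⟨B h, z⟩}`. The chirps `e^{πi ⟨B z, z⟩}` with `B` symmetric are the model. -/
structure IsQuadraticCharacter (c : V → ℂ) (B : V →ₗ[ℝ] V) : Prop where
  hasTemperateGrowth : c.HasTemperateGrowth
  norm_eq_one : ∀ z, ‖c z‖ = 1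
  apply_add : ∀ z h, c (z + h) = c z * c h *
    Complex.exp (((2 * Real.pi * inner ℝ (B h) z : ℝ) : ℂ) * Complex.I)

theorem IsQuadraticCharacter.smulLeftCLM_timeFreqShift {c : V → ℂ} {B : V →ₗ[ℝ] V}
    (hc : IsQuadraticCharacter c B) (x ξ : V) (b : 𝓢(V, ℂ)) :
    SchwartzMap.smulLeftCLM ℂ c (timeFreqShift x ξ b) =
      (c x * Complex.exp (((-(2 * Real.pi * inner ℝ (B x) x) : ℝ) : ℂ) * Complex.I)) •
        timeFreqShift x (ξ + B x) (SchwartzMap.smulLeftCLM ℂ c b) := by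
  ext t
  have split : c t = c (t - x) * c x *
      Complex.exp (((2 * Real.pi * inner ℝ (B x) (t - x) : ℝ) : ℂ) * Complex.I) := by
    rw [← hc.apply_add, sub_add_cancel]
  have phases :
      Complex.exp (((2 * Real.pi * inner ℝ (B x) (t - x) : ℝ) : ℂ) * Complex.I) *
        Complex.exp (((2 * Real.pi * inner ℝ ξ t : ℝ) : ℂ) * Complex.I) =
      Complex.exp (((-(2 * Real.pi * inner ℝ (B x) x) : ℝ) : ℂ) * Complex.I) *
        Complex.exp (((2 * Real.pi * inner ℝ (ξ + B x) t : ℝ) : ℂ) * Complex.I) := by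
    rw [← Complex.exp_add, ← Complex.exp_add]
    congr 1
    simp only [inner_sub_right, inner_add_left]
    push_cast
    ring
  simp only [smul_apply, SchwartzMap.smulLeftCLM_apply_apply hc.hasTemperateGrowth,
    timeFreqShift_apply, smul_eq_mul]
  rw [split]
  linear_combination c (t - x) * c x * b (t - x) * phases

theorem enorm_stft_delta (g : 𝓢(V, ℂ)) (x₀ x ξ : V) :
    ‖stft g (delta x₀) x ξ‖ₑ = ‖g (x₀ - x)‖ₑ := by
  rw [stft, delta_apply, conjS_apply, RCLike.enorm_conj, timeFreqShift_apply, enorm_mul,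
    Complex.enorm_exp_ofReal_mul_I, one_mul]

variable [FiniteDimensional ℝ V] [MeasurableSpace V] [BorelSpace V]

theorem fourierInv_timeFreqShift (x ξ : V) (b : 𝓢(V, ℂ)) :
    𝓕⁻ (timeFreqShift x ξ b) =
      Complex.exp (((2 * Real.pi * inner ℝ x ξ : ℝ) : ℂ) * Complex.I) •
        timeFreqShift (-ξ) x (𝓕⁻ b) := by
  rw [← (FourierTransform.fourierEquiv ℂ 𝓢(V, ℂ)).injective.eq_iff,
    FourierTransform.fourierEquiv_apply, FourierTransform.fourierEquiv_apply,
    FourierTransform.fourier_smul, fourier_timeFreqShift, smul_smul, ← Complex.exp_add]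
  simp [real_inner_comm]

theorem IsQuadraticCharacter.exists_fourier_smulLeftCLM_fourierInv_timeFreqShift {c : V → ℂ}
    {B : V →ₗ[ℝ] V} (hc : IsQuadraticCharacter c B) (x ξ : V) (b : 𝓢(V, ℂ)) :
    ∃ a : ℂ, ‖a‖ = 1 ∧ 𝓕 (SchwartzMap.smulLeftCLM ℂ c (𝓕⁻ (timeFreqShift x (-ξ) b))) =
      a • timeFreqShift (x + B ξ) (-ξ) (𝓕 (SchwartzMap.smulLeftCLM ℂ c (𝓕⁻ b))) := by
  rw [fourierInv_timeFreqShift, neg_neg, map_smul, hc.smulLeftCLM_timeFreqShift,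
    FourierTransform.fourier_smul, FourierTransform.fourier_smul, fourier_timeFreqShift,
    smul_smul, smul_smul]
  refine ⟨_, ?_, rfl⟩
  simp only [norm_mul, Complex.norm_exp_ofReal_mul_I, hc.norm_eq_one, mul_one]

/-- The window whose short-time Fourier transform represents that of the Fourier multiplier `c`
taken with the window `g`: the multiplier transposed onto `g`. -/
def multiplierWindow (c : V → ℂ) (g : 𝓢(V, ℂ)) : 𝓢(V, ℂ) :=
  conjS (𝓕 (SchwartzMap.smulLeftCLM ℂ c (𝓕⁻ (conjS g))))

theorem IsQuadraticCharacter.multiplierWindow_ne_zero {c : V → ℂ} {B : V →ₗ[ℝ] V}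
    (hc : IsQuadraticCharacter c B) {g : 𝓢(V, ℂ)} (hg : g ≠ 0) : multiplierWindow c g ≠ 0 := by
  have conjS_inj : Function.Injective (conjS : 𝓢(V, ℂ) → 𝓢(V, ℂ)) :=
    Function.Involutive.injective conjS_conjS
  have smul_inj : Function.Injective (SchwartzMap.smulLeftCLM ℂ c : 𝓢(V, ℂ) → 𝓢(V, ℂ)) := by
    intro φ ψ h
    ext t
    have hct : c t ≠ 0 := norm_ne_zero_iff.1 (hc.norm_eq_one t ▸ one_ne_zero)
    have := congr($h t)
    simpa only [SchwartzMap.smulLeftCLM_apply_apply hc.hasTemperateGrowth, smul_eq_mul,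
      mul_right_inj' hct] using this
  have fourier_inj := (FourierTransform.fourierEquiv ℂ 𝓢(V, ℂ)).injective
  have fourierInv_inj := (FourierTransform.fourierEquiv ℂ 𝓢(V, ℂ)).symm.injective
  have zero : multiplierWindow c 0 = 0 := by
    simp [multiplierWindow, FourierTransform.fourierInv_zero, FourierTransform.fourier_zero]
  rw [← zero]
  exact (conjS_inj.comp (fourier_inj.comp (smul_inj.comp (fourierInv_inj.comp conjS_inj)))).ne hg

theorem IsQuadraticCharacter.norm_stft_fourierMultiplierCLM {c : V → ℂ} {B : V →ₗ[ℝ] V}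
    (hc : IsQuadraticCharacter c B) (g : 𝓢(V, ℂ)) (u : 𝓢'(V, ℂ)) (x ξ : V) :
    ‖stft g (fourierMultiplierCLM ℂ c u) x ξ‖ =
      ‖stft (multiplierWindow c g) u (x + B ξ) ξ‖ := by
  obtain ⟨a, ha, h⟩ :=
    hc.exists_fourier_smulLeftCLM_fourierInv_timeFreqShift x ξ (conjS g)
  rw [stft_eq, fourierMultiplierCLM_apply_apply, h, map_smul, norm_smul, ha, one_mul, stft_eq,
    multiplierWindow, conjS_conjS]

theorem IsQuadraticCharacter.eLpNorm_stft_fourierMultiplierCLM {c : V → ℂ} {B : V →ₗ[ℝ] V}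
    (hc : IsQuadraticCharacter c B) (g : 𝓢(V, ℂ)) (u : 𝓢'(V, ℂ)) (p : ℝ≥0∞) (ξ : V) :
    eLpNorm (fun x => stft g (fourierMultiplierCLM ℂ c u) x ξ) p volume =
      eLpNorm (fun x => stft (multiplierWindow c g) u x ξ) p volume := by
  rw [← eLpNorm_comp_measurePreserving
    (continuous_stft_left (multiplierWindow c g) u ξ).aestronglyMeasurable
    (measurePreserving_add_right volume (B ξ))]
  exact eLpNorm_congr_norm_ae (.of_forall fun x => hc.norm_stft_fourierMultiplierCLM g u x ξ)

theorem IsQuadraticCharacter.fourierMultiplierCLM_mem_modulationSpace_iff {c : V → ℂ}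
    {B : V →ₗ[ℝ] V} (hc : IsQuadraticCharacter c B) {g : 𝓢(V, ℂ)} (hg : g ≠ 0) (u : 𝓢'(V, ℂ))
    {p q : ℝ≥0∞} (hp : 1 ≤ p) (hq : 1 ≤ q) :
    fourierMultiplierCLM ℂ c u ∈ modulationSpace g p q ↔ u ∈ modulationSpace g p q := by
  rw [modulationSpace_eq hg (hc.multiplierWindow_ne_zero hg) hp hq]
  conv_lhs => rw [← modulationSpace_eq hg (hc.multiplierWindow_ne_zero hg) hp hq]
  simp only [modulationSpace, Set.mem_ofPred_eq, hc.eLpNorm_stft_fourierMultiplierCLM]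

theorem delta_mem_modulationSpace (g : 𝓢(V, ℂ)) (x₀ : V) :
    delta x₀ ∈ modulationSpace g 1 ⊤ := by
  have slice_norm (ξ : V) : eLpNorm (fun x => stft g (delta x₀) x ξ) 1 volume = eLpNorm g 1 := by
    simp only [eLpNorm_one_eq_lintegral_enorm, enorm_stft_delta]
    exact lintegral_sub_left_eq_self (fun x => ‖g x‖ₑ) x₀
  rw [modulationSpace, Set.mem_ofPred_eq]
  simp only [slice_norm]
  exact (eLpNorm_top_le_iff.2 (.of_forall fun _ => le_rfl)).trans_lt
    (g.eLpNorm_lt_top 1 volume)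

theorem lintegral_comp_add_linearMap {B : V →ₗ[ℝ] V} (hB : LinearMap.det B ≠ 0) {f : V → ℝ≥0∞}
    (hf : Measurable f) (x : V) :
    ∫⁻ ξ, f (x + B ξ) = ENNReal.ofReal |(LinearMap.det B)⁻¹| * ∫⁻ v, f v := by
  have hB_meas : Measurable B := B.continuous_of_finiteDimensional.measurable
  rw [← lintegral_map (f := fun v => f (x + v)) (by fun_prop) hB_meas,
    Measure.map_linearMap_addHaar_eq_smul_addHaar _ hB, lintegral_smul_measure,
    lintegral_add_left_eq_self, smul_eq_mul]

theorem IsQuadraticCharacter.fourierMultiplierCLM_delta_mem_wienerAmalgam {c : V → ℂ}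
    {B : V →ₗ[ℝ] V} (hc : IsQuadraticCharacter c B) (hB : LinearMap.det B ≠ 0) (g : 𝓢(V, ℂ))
    (x₀ : V) : fourierMultiplierCLM ℂ c (delta x₀) ∈ wienerAmalgam g 1 ⊤ := by
  let h := multiplierWindow c g
  have enorm_stft (x ξ : V) :
      ‖stft g (fourierMultiplierCLM ℂ c (delta x₀)) x ξ‖ₑ = ‖h (x₀ - (x + B ξ))‖ₑ := by
    rw [← enorm_stft_delta, enorm_eq_iff_norm_eq, hc.norm_stft_fourierMultiplierCLM]
  have slice_norm (x : V) :
      eLpNorm (fun ξ => stft g (fourierMultiplierCLM ℂ c (delta x₀)) x ξ) 1 volume =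
        ENNReal.ofReal |(LinearMap.det B)⁻¹| * eLpNorm h 1 := by
    have h_meas : Measurable fun v => ‖h (x₀ - v)‖ₑ :=
      (h.continuous.comp (continuous_const.sub continuous_id)).enorm.measurable
    simp only [eLpNorm_one_eq_lintegral_enorm, enorm_stft, lintegral_comp_add_linearMap hB h_meas]
    rw [lintegral_sub_left_eq_self (fun v => ‖h v‖ₑ) x₀]
  rw [wienerAmalgam, Set.mem_ofPred_eq]
  simp only [slice_norm]
  exact (eLpNorm_top_le_iff.2 (.of_forall fun _ => le_rfl)).trans_lt
    (ENNReal.mul_lt_top ENNReal.ofReal_lt_top (h.eLpNorm_lt_top 1 volume))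

end FourierMultiplier

section Inversion

variable {V : Type} [NormedAddCommGroup V] [InnerProductSpace ℝ V] [FiniteDimensional ℝ V]
  [MeasurableSpace V] [BorelSpace V]

theorem fourierInv_apply_eq_fourier_neg (φ : 𝓢(V, ℂ)) (z : V) : 𝓕⁻ φ z = 𝓕 φ (-z) :=
  congr($(SchwartzMap.fourierInv_apply_eq φ) z)

theorem fourier_fourier_apply (φ : 𝓢(V, ℂ)) (z : V) : 𝓕 (𝓕 φ) z = φ (-z) := by
  rw [← neg_neg z, ← fourierInv_apply_eq_fourier_neg, FourierTransform.fourierInv_fourier_eq,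
    neg_neg]

end Inversion

section Pair

variable {d : ℕ}

/-- The identification of `ℝ^d × ℝ^d` with `ℝ^{2d}`, as a measurable equivalence. -/
def pairEquiv (d : ℕ) : Rd d × Rd d ≃ᵐ Rdd d :=
  (MeasurableEquiv.toLp 2 _).trans
    (PiLp.sumPiLpEquivProdLpPiLp 2 fun _ : Fin d ⊕ Fin d => ℝ).symm.toMeasurableEquiv

theorem pairEquiv_apply (z : Rd d × Rd d) : pairEquiv d z = pair z.1 z.2 := by
  ext i
  rcases i with i | i <;> rfl

theorem measurePreserving_pairEquiv : MeasurePreserving (pairEquiv d) :=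
  (PiLp.sumPiLpEquivProdLpPiLp 2 fun _ : Fin d ⊕ Fin d => ℝ).symm.measurePreserving.comp
    (WithLp.volume_preserving_toLp _ _)

theorem integral_eq_integral_pair {E : Type*} [NormedAddCommGroup E] [NormedSpace ℝ E]
    {F : Rdd d → E} (hF : Integrable F) : ∫ z, F z = ∫ x, ∫ y, F (pair x y) := by
  have hF_pair : Integrable fun z => F (pairEquiv d z) :=
    (measurePreserving_pairEquiv.integrable_comp_emb (pairEquiv d).measurableEmbedding).2 hF
  rw [← measurePreserving_pairEquiv.integral_comp', Measure.volume_eq_prod,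
    integral_prod _ hF_pair]
  simp only [pairEquiv_apply]

theorem norm_inlL_apply (x : Rd d) : ‖inlL x‖ = ‖x‖ := by
  simp [inlL, EuclideanSpace.norm_eq]

/-- The restriction `x ↦ Φ(x, y)` of a Schwartz function on `ℝ^{2d}`; `slice` fixes the other
coordinate. -/
def sliceSnd (y : Rd d) : 𝓢(Rdd d, ℂ) →L[ℂ] 𝓢(Rd d, ℂ) :=
  SchwartzMap.compCLMOfAntilipschitz ℂ (K := 1) (g := fun x => pair x y)
    (by simp only [pair_eq]; fun_prop)
    (AntilipschitzWith.of_le_mul_dist fun x x' => by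
      simp [pair_eq, dist_eq_norm, ← map_sub, norm_inlL_apply])

theorem sliceSnd_apply (y : Rd d) (Φ : 𝓢(Rdd d, ℂ)) (x : Rd d) :
    sliceSnd y Φ x = Φ (pair x y) := rfl

theorem fourier_sliceSnd_partialFourierSchwartz (φ : 𝓢(Rdd d, ℂ)) (y ζ : Rd d) :
    𝓕 (sliceSnd y (partialFourierSchwartz φ)) ζ = 𝓕 φ (pair ζ y) := by
  have integrable : Integrable fun z : Rdd d =>
      Complex.exp (((-2 * Real.pi * inner ℝ z (pair ζ y) : ℝ) : ℂ) * Complex.I) • φ z := by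
    simpa only [Real.fourierChar_apply, Circle.smul_def, mul_neg, neg_mul] using
      (Real.fourierIntegral_convergent_iff (μ := volume) (pair ζ y)).2 φ.integrable
  rw [SchwartzMap.fourier_coe, SchwartzMap.fourier_coe, Real.fourier_eq', Real.fourier_eq',
    integral_eq_integral_pair integrable]
  congr! 2 with x
  simp only [sliceSnd_apply, partialFourierSchwartz_apply, smul_eq_mul, inner_eq_add, fstL_pair,
    sndL_pair]
  rw [← integral_const_mul]
  congr! 2
  rw [← mul_assoc, ← Complex.exp_add]
  congr 2
  push_cast
  ring

theorem partialFourierSchwartz_eq_integral (φ : 𝓢(Rdd d, ℂ)) (x y : Rd d) :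
    partialFourierSchwartz φ (pair x y) =
      ∫ ζ, Complex.exp (((2 * Real.pi * inner ℝ ζ x : ℝ) : ℂ) * Complex.I) * 𝓕 φ (pair ζ y) := by
  rw [← sliceSnd_apply,
    ← FourierTransform.fourierInv_fourier_eq (F := 𝓢(Rd d, ℂ))
      (sliceSnd y (partialFourierSchwartz φ)),
    SchwartzMap.fourierInv_coe, Real.fourierInv_eq']
  simp only [fourier_sliceSnd_partialFourierSchwartz, smul_eq_mul]

theorem toEuclideanLin_fromBlocks (A B C D : Matrix (Fin d) (Fin d) ℝ) (v : Rdd d) :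
    Matrix.toEuclideanLin (Matrix.fromBlocks A B C D) v =
      pair (Matrix.toEuclideanLin A (fstL v) + Matrix.toEuclideanLin B (sndL v))
        (Matrix.toEuclideanLin C (fstL v) + Matrix.toEuclideanLin D (sndL v)) := by
  ext i
  rw [Matrix.toLpLin_apply, Matrix.fromBlocks_mulVec]
  rcases i with i | i <;> simp [pair, Matrix.toLpLin_apply] <;> rfl

end Pair

section DualChirp

variable {d : ℕ}

/-- The chirp `χ_M ∘ J : (x, y) ↦ e^{-2πi x·My}`, the Fourier multiplier by which `ℬ_{A_M} f` is
obtained from `W f`. -/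
def dualChirp (M : Matrix (Fin d) (Fin d) ℝ) (z : Rdd d) : ℂ :=
  Complex.exp (((-(2 * Real.pi * inner ℝ (fstL z) (Matrix.toEuclideanLin M (sndL z))) : ℝ) : ℂ) *
    Complex.I)

/-- The symmetric matrix of the quadratic form `-2 x·My` in the phase of `dualChirp M`. -/
def dualChirpMatrix (M : Matrix (Fin d) (Fin d) ℝ) : Matrix (Fin d ⊕ Fin d) (Fin d ⊕ Fin d) ℝ :=
  Matrix.fromBlocks 0 (-M) (-M.transpose) 0

theorem hasTemperateGrowth_dualChirp (M : Matrix (Fin d) (Fin d) ℝ) :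
    (dualChirp M).HasTemperateGrowth := by
  have bilinear := ContinuousLinearMap.bilinear_hasTemperateGrowth (𝕜 := ℝ) (innerSL ℝ)
    (fstL (d := d)).hasTemperateGrowth
    ((Matrix.toEuclideanLin M).toContinuousLinearMap.comp sndL).hasTemperateGrowth
  exact hasTemperateGrowth_cexp_ofReal_mul_I.comp
    ((Function.HasTemperateGrowth.const (2 * Real.pi)).mul bilinear).neg

theorem isQuadraticCharacter_dualChirp (M : Matrix (Fin d) (Fin d) ℝ) :
    IsQuadraticCharacter (dualChirp M) (Matrix.toEuclideanLin (dualChirpMatrix M)) where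
  hasTemperateGrowth := hasTemperateGrowth_dualChirp M
  norm_eq_one z := Complex.norm_exp_ofReal_mul_I _
  apply_add z h := by
    have adjoint (a b : Rd d) : inner ℝ (Matrix.toEuclideanLin M.transpose a) b =
        inner ℝ a (Matrix.toEuclideanLin M b) := by
      rw [← Matrix.conjTranspose_eq_transpose_of_trivial,
        Matrix.toEuclideanLin_conjTranspose_eq_adjoint, LinearMap.adjoint_inner_left]
    rw [dualChirpMatrix, toEuclideanLin_fromBlocks, inner_eq_add, fstL_pair, sndL_pair, dualChirp,
      dualChirp, dualChirp, ← Complex.exp_add, ← Complex.exp_add]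
    congr 1
    simp only [map_add, map_neg, map_zero, LinearMap.zero_apply, LinearMap.neg_apply, zero_add,
      add_zero, inner_add_left, inner_add_right, inner_neg_left, inner_neg_right, adjoint,
      real_inner_comm (fstL z)]
    push_cast
    ring

theorem det_dualChirpMatrix_ne_zero {M : Matrix (Fin d) (Fin d) ℝ} (hM : IsUnit M) :
    (dualChirpMatrix M).det ≠ 0 := by
  obtain ⟨N, hMN⟩ := hM.exists_right_inv
  refine Matrix.det_ne_zero_of_right_inverse (B := Matrix.fromBlocks 0 (-N.transpose) (-N) 0) ?_
  simp [dualChirpMatrix, Matrix.fromBlocks_multiply, ← Matrix.transpose_mul, hMN,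
    mul_eq_one_comm.1 hMN]

theorem dualChirp_neg (M : Matrix (Fin d) (Fin d) ℝ) (z : Rdd d) :
    dualChirp M (-z) = dualChirp M z := by
  simp [dualChirp]

end DualChirp

section Wigner

variable {d : ℕ}

theorem partialFourierSchwartz_fourier_smulLeftCLM_dualChirp (M : Matrix (Fin d) (Fin d) ℝ)
    (φ : 𝓢(Rdd d, ℂ)) (x y : Rd d) :
    partialFourierSchwartz (𝓕 (SchwartzMap.smulLeftCLM ℂ (dualChirp M) (𝓕⁻ φ))) (pair x y) =
      partialFourierSchwartz φ (pair (x - Matrix.toEuclideanLin M y) y) := by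
  rw [partialFourierSchwartz_eq_integral, partialFourierSchwartz_eq_integral]
  congr! 2 with ζ
  rw [fourier_fourier_apply, SchwartzMap.smulLeftCLM_apply_apply (hasTemperateGrowth_dualChirp M),
    dualChirp_neg, fourierInv_apply_eq_fourier_neg, neg_neg, smul_eq_mul, ← mul_assoc, dualChirp,
    ← Complex.exp_add, fstL_pair, sndL_pair, inner_sub_right]
  congr 2
  push_cast
  ring

theorem det_cohenMatrix (M : Matrix (Fin d) (Fin d) ℝ) :
    (cohenMatrix M).val.det = (wignerMatrix d).val.det := by
  have h : (cohenMatrix M).val = (wignerMatrix d).val * Matrix.fromBlocks 1 M 0 1 := by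
    simp [cohenMatrix, wignerMatrix, Matrix.fromBlocks_multiply, sub_eq_add_neg]
  rw [h, Matrix.det_mul, Matrix.det_fromBlocks_zero₂₁, Matrix.det_one, mul_one, mul_one]

theorem partialFourierSchwartz_matEquiv_cohenMatrix_symm (M : Matrix (Fin d) (Fin d) ℝ)
    (φ : 𝓢(Rdd d, ℂ)) (v : Rdd d) :
    partialFourierSchwartz φ ((matEquiv (cohenMatrix M)).symm v) =
      partialFourierSchwartz (𝓕 (SchwartzMap.smulLeftCLM ℂ (dualChirp M) (𝓕⁻ φ)))
        ((matEquiv (wignerMatrix d)).symm v) := by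
  have cohen_symm : (matEquiv (cohenMatrix M)).symm v = Matrix.toEuclideanLin
      (Matrix.fromBlocks ((1 / 2 : ℝ) • 1 - M) (M + (1 / 2 : ℝ) • 1) 1 (-1)) v := rfl
  have wigner_symm : (matEquiv (wignerMatrix d)).symm v = Matrix.toEuclideanLin
      (Matrix.fromBlocks ((1 / 2 : ℝ) • 1) ((1 / 2 : ℝ) • 1) 1 (-1)) v := rfl
  rw [cohen_symm, wigner_symm, toEuclideanLin_fromBlocks, toEuclideanLin_fromBlocks,
    partialFourierSchwartz_fourier_smulLeftCLM_dualChirp]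
  congr 2
  simp only [map_sub, map_add, map_neg, LinearMap.sub_apply, LinearMap.add_apply,
    LinearMap.neg_apply, Matrix.toLpLin_one, LinearMap.id_apply]
  abel

theorem matrixWigner_apply (A : GL (Fin d ⊕ Fin d) ℝ) (f g : 𝓢'(Rd d, ℂ)) (φ : 𝓢(Rdd d, ℂ)) :
    matrixWigner A f g φ = ((|A.val.det|⁻¹ : ℝ) : ℂ) • tensor f (conjD g)
      (SchwartzMap.compCLMOfContinuousLinearEquiv ℂ (matEquiv A).symm
        (partialFourierSchwartz φ)) := rfl

theorem matrixWigner_cohenMatrix (M : Matrix (Fin d) (Fin d) ℝ) (f g : 𝓢'(Rd d, ℂ)) :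
    matrixWigner (cohenMatrix M) f g = TemperedDistribution.fourierMultiplierCLM ℂ (dualChirp M)
      (matrixWigner (wignerMatrix d) f g) := by
  ext φ
  rw [TemperedDistribution.fourierMultiplierCLM_apply_apply, matrixWigner_apply,
    matrixWigner_apply, det_cohenMatrix]
  congr 2
  ext v
  exact partialFourierSchwartz_matEquiv_cohenMatrix_symm M φ v

end Wigner

section Theta

variable {d : ℕ}

/-- The symplectic matrix `J` as a linear isometry of `ℝ^{2d}`. -/
def symplecticIsometry (d : ℕ) : Rdd d ≃ₗᵢ[ℝ] Rdd d where
  toLinearEquiv := (matEquiv (symplecticJ d)).toLinearEquiv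
  norm_map' z := by
    have apply_eq : (matEquiv (symplecticJ d)).toLinearEquiv z =
        Matrix.toEuclideanLin (Matrix.fromBlocks 0 1 (-1) 0) z := rfl
    rw [← sq_eq_sq₀ (norm_nonneg _) (norm_nonneg _), apply_eq, toEuclideanLin_fromBlocks]
    conv_rhs => rw [← pair_fstL_sndL z]
    rw [norm_sq_pair, norm_sq_pair]
    simp [add_comm]

theorem symplecticIsometry_apply (z : Rdd d) :
    symplecticIsometry d z = pair (sndL z) (-(fstL z)) := by
  have apply_eq : symplecticIsometry d z =
      Matrix.toEuclideanLin (Matrix.fromBlocks 0 1 (-1) 0) z := rfl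
  rw [apply_eq, toEuclideanLin_fromBlocks]
  simp

theorem det_symplecticJ : (symplecticJ d).val.det = 1 := by
  have h : (symplecticJ d).val = -Matrix.J (Fin d) ℝ := by
    simp [symplecticJ, Matrix.J, Matrix.fromBlocks_neg]
  rw [h]
  exact SymplecticGroup.det_eq_one (SymplecticGroup.neg_mem (SymplecticGroup.J_mem _ _))

theorem chirp_symplecticIsometry (M : Matrix (Fin d) (Fin d) ℝ) (z : Rdd d) :
    chirp M (symplecticIsometry d z) = dualChirp M z := by
  rw [symplecticIsometry_apply, chirp, dualChirp, fstL_pair, sndL_pair, inner_neg_left, mul_neg]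

theorem theta_apply (M : Matrix (Fin d) (Fin d) ℝ) (φ : 𝓢(Rdd d, ℂ)) :
    theta M φ = ∫ z, 𝓕 φ z * dualChirp M z := by
  let J := symplecticIsometry d
  have theta_eq : theta M φ = ((|(symplecticJ d).val.det|⁻¹ : ℝ) : ℂ) •
      ∫ z, 𝓕 (SchwartzMap.compCLMOfContinuousLinearEquiv ℂ (matEquiv (symplecticJ d)).symm φ) z •
        chirp M z := rfl
  have fourier_comp (z : Rdd d) :
      𝓕 (SchwartzMap.compCLMOfContinuousLinearEquiv ℂ (matEquiv (symplecticJ d)).symm φ) (J z) =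
        𝓕 φ z := by
    rw [SchwartzMap.fourier_coe]
    change 𝓕 (φ ∘ J.symm) (J z) = _
    rw [Real.fourier_comp_linearIsometry, LinearIsometryEquiv.symm_apply_apply,
      SchwartzMap.fourier_coe]
  rw [theta_eq, det_symplecticJ, abs_one, inv_one, Complex.ofReal_one, one_smul,
    ← J.measurePreserving.integral_comp J.toHomeomorph.measurableEmbedding]
  simp only [fourier_comp, smul_eq_mul, J, chirp_symplecticIsometry]

theorem theta_eq (M : Matrix (Fin d) (Fin d) ℝ) :
    theta M = TemperedDistribution.fourierMultiplierCLM ℂ (dualChirp M)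
      (TemperedDistribution.delta 0) := by
  ext φ
  rw [TemperedDistribution.fourierMultiplierCLM_apply_apply, TemperedDistribution.delta_apply,
    SchwartzMap.fourier_coe, Real.fourier_eq', theta_apply, ← integral_neg_eq_self]
  congr! 2 with z
  rw [SchwartzMap.smulLeftCLM_apply_apply (hasTemperateGrowth_dualChirp M),
    fourierInv_apply_eq_fourier_neg, dualChirp_neg]
  simp [mul_comm]

end Theta

end CohenClass
end

theorem theorem1p2 (d : ℕ) (M : Matrix (Fin d) (Fin d) ℝ) (hM : IsUnit M)
    (g : 𝓢(Rdd d, ℂ)) (hg : g ≠ 0) :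
    theta M ∈ modulationSpace g 1 ⊤ ∩ wienerAmalgam g 1 ⊤ ∧
      ∀ (f : 𝓢'(Rd d, ℂ)) (p q : ℝ≥0∞), 1 ≤ p → 1 ≤ q →
        (wigner f ∈ modulationSpace g p q ↔ perturbedWigner M f ∈ modulationSpace g p q) := by
  have hc := isQuadraticCharacter_dualChirp M
  have hdet : LinearMap.det (Matrix.toEuclideanLin (dualChirpMatrix M)) ≠ 0 := by
    rw [LinearMap.det_toLpLin]
    exact det_dualChirpMatrix_ne_zero hM
  refine ⟨⟨?_, ?_⟩, fun f p q hp hq => ?_⟩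
  · rw [theta_eq, hc.fourierMultiplierCLM_mem_modulationSpace_iff hg _ le_rfl le_top]
    exact delta_mem_modulationSpace g 0
  · rw [theta_eq]
    exact hc.fourierMultiplierCLM_delta_mem_wienerAmalgam hdet g 0
  · rw [perturbedWigner, matrixWigner_cohenMatrix,
      hc.fourierMultiplierCLM_mem_modulationSpace_iff hg _ hp hq, wigner]
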